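/- Let $\sigma\in\mathbb{R}$ with $\sigma^2>0$, let $p>2$ and $1<q<p$, and consider the double-well potential $\Phi(w)=|w|^p-|w|^q$. For $K\in(0,\infty]$ put $I_K=(-K,K]$ if $K<\infty$ and $I_\infty=\mathbb{R}$; for finite $K$, functions on $I_K$ are identified with $2K$-periodic functions on $\mathbb{R}$. Set $$(\mathcal{A}W)(\varphi)=\int_{\varphi-1/2}^{\varphi+1/2}W(s)\,ds,\qquad \Psi_r(w)=r\,\mathrm{sgn}(w)|w|^{r-1},$$ $$X_K=\{W\in L^2(I_K):\ \mathcal{A}W\in L^q(I_K)\cap L^p(I_K)\},$$ $$\mathcal{L}_K(W)=\tfrac12\sigma^2\int_{I_K}W^2\,d\varphi-\int_{I_K}\Phi(\mathcal{A}W)\,d\varphi=\tfrac12\sigma^2\|W\|_{L^2(I_K)}^2+\int_{I_K}|\mathcal{A}W|^q\,d\varphi-\int_{I_K}|\mathcal{A}W|^p\,d\varphi .$$ We write $\partial\mathcal{L}_K(W)=0$ if $\frac{d}{dt}\mathcal{L}_K(W+tV)|_{t=0}$ exists and equals $0$ for every $V\in X_K$. A ground wave (periodic if $K<\infty$, solitary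 if $K=\infty$) is a function $W\in X_K\setminus\{0\}$ with $\partial\mathcal{L}_K(W)=0$ that solves the traveling wave equation $$\sigma^2W+\mathcal{A}\Psi_q(\mathcal{A}W)=\mathcal{A}\Psi_p(\mathcal{A}W)\quad\text{a.e.}\tag{1}$$ and whose action $\mathcal{L}_K(W)$ is minimal among all $U\in X_K\setminus\{0\}$ with $\partial\mathcal{L}_K(U)=0$. Then: 1. For every $K\in(0,\infty]$ there exists a ground wave $W_K\in X_K$; it satisfies (1) and $$0<\mathcal{L}_K(W_K)=\min\{\mathcal{L}_K(W):\ W\in X_K\setminus\{0\},\ \partial\mathcal{L}_K(W)=0\}.$$ 2. There is $K_0<\infty$ such that for every $K\in(K_0,\infty]$ with $K>0$ no ground wave in $X_K$ is (a.e. equal to) a constant. 3. Every unbounded sequence $(K_m)_{m\in\mathbb{N}}$ in $(0,\infty)$ has a subsequence $(K_{m_n})_{n\in\mathbb{N}}$ with $K_{m_n}\to\infty$ for which there are periodic ground waves $W_n\in X_{K_{m_n}}$ and a solitary ground wave $W_\infty\in X_\infty$ with $\|W_\infty-V_n\|_{L^2(\mathbb{R})}\to0$ as $n\to\infty$, where $V_n=W_n$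 on $I_{K_{m_n}}$ and $V_n=0$ outside $I_{K_{m_n}}$. -/

import Mathlib

open MeasureTheory Filter Topology Set
open scoped ENNReal

noncomputable section

namespace GroundWaves

/-- The periodicity cell: `(-K, K]` for finite `K`, the whole line for `K = ∞`. -/
def cell (K : ℝ≥0∞) : Set ℝ :=
  if K = ∞ then Set.univ else Set.Ioc (-K.toReal) K.toReal

/-- Lebesgue measure on the cell. -/
def cellMeasure (K : ℝ≥0∞) : Measure ℝ := volume.restrict (cell K)

/-- The convolution operator `(A W)(φ) = ∫_{φ-1/2}^{φ+1/2} W(s) ds`. -/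
def avg (W : ℝ → ℝ) (φ : ℝ) : ℝ := ∫ s in (φ - 1 / 2)..(φ + 1 / 2), W s

/-- `Ψ_r(w) = r sgn(w) |w|^(r-1)`. -/
def Psi (r w : ℝ) : ℝ := r * Real.sign w * |w| ^ (r - 1)

/-- The ansatz space `X_K`: functions on the line (`2K`-periodic if `K < ∞`) that are square
integrable on the cell and whose average is in `L^q ∩ L^p` on the cell. Elements stand for their
almost everywhere classes. -/
def ansatz (p q : ℝ) (K : ℝ≥0∞) : Set (ℝ → ℝ) :=
  {W | (K ≠ ∞ → Function.Periodic W (2 * K.toReal)) ∧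
    MemLp W 2 (cellMeasure K) ∧
    MemLp (avg W) (ENNReal.ofReal q) (cellMeasure K) ∧
    MemLp (avg W) (ENNReal.ofReal p) (cellMeasure K)}

/-- `∫_{I_K} |A W|^r dφ`. -/
def potentialPart (r : ℝ) (K : ℝ≥0∞) (W : ℝ → ℝ) : ℝ :=
  ∫ φ, |avg W φ| ^ r ∂(cellMeasure K)

/-- The Lagrangian action functional. -/
def action (σ p q : ℝ) (K : ℝ≥0∞) (W : ℝ → ℝ) : ℝ :=
  1 / 2 * σ ^ 2 * (∫ φ, W φ ^ 2 ∂(cellMeasure K)) + potentialPart q K W - potentialPart p K W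

/-- The traveling wave equation `σ² W + A Ψ_q(A W) = A Ψ_p(A W)`, almost everywhere. -/
def TravelingWaveEq (σ p q : ℝ) (W : ℝ → ℝ) : Prop :=
  ∀ᵐ φ, σ ^ 2 * W φ + avg (fun s => Psi q (avg W s)) φ = avg (fun s => Psi p (avg W s)) φ

/-- The Gâteaux derivative of the action on `X_K` exists at `W` and vanishes. -/
def ActionCritical (σ p q : ℝ) (K : ℝ≥0∞) (W : ℝ → ℝ) : Prop :=
  ∀ V ∈ ansatz p q K, HasDerivAt (fun t : ℝ => action σ p q K (W + t • V)) 0 0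

/-- The nontrivial critical points of the action in `X_K`. -/
def nontrivialCriticalPoints (σ p q : ℝ) (K : ℝ≥0∞) : Set (ℝ → ℝ) :=
  {W | W ∈ ansatz p q K ∧ ¬ (W =ᵐ[volume] 0) ∧ ActionCritical σ p q K W}

/-- A ground wave is a traveling wave that is a nontrivial critical point of the action and
realizes the least action among all nontrivial critical points. -/
structure IsGroundWave (σ p q : ℝ) (K : ℝ≥0∞) (W : ℝ → ℝ) : Prop where
  mem : W ∈ nontrivialCriticalPoints σ p q K
  wave_eq : TravelingWaveEq σ p q W
  isLeast : IsLeast (action σ p q K '' nontrivialCriticalPoints σ p q K) (action σ p q K W)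

end GroundWaves

end

noncomputable section

namespace GroundWaves

/-! ### The fibre map `t ↦ S t² a / 2 + t^q b - t^p c` -/

/-! The proof is the Nehari manifold method. Along a ray, `action` of `t • W` is `S t² a / 2 + t^q b
- t^p c` with `S = σ²`, `a = mass`, and `b`, `c` the two potential parts. Since `p` exceeds both `2`
and `q`, this function rises and then falls whenever `a, c > 0`, so the ray meets the set `nehari =
0` exactly once, at the maximum of the action. Every nontrivial critical point lies on this set
(test with `V = W`). There the `p`-term can be eliminated, and the action becomes `reducedAction`, a
sum of nonnegative terms that controls the mass and the `q`-part and is well behaved under weak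
limits. A minimizer of `reducedAction` on the Nehari set is a critical point: if some variation
lowered the action, the perturbed rays would still cross the set near `t = 1`, at a point of lower
action (`fibre_variation_nonneg`). No multiplier rule is needed. It is then minimal among all
critical points, and the wave equation is the Euler-Lagrange equation, obtained from the symmetry of
`avg`. Existence rests on a nonvanishing estimate: `nehari ≤ 0` forces `|avg W| ≥ η` somewhere, with
`p η^(p-2) < σ²` (`exists_le_abs_avg`). After a translation this happens at `0`, so weak limits are
nonzero. On a bounded cell averaging turns weak into pointwise convergence, both potential parts
converge, and only the mass can drop. The limit then has `nehari ≤ 0`; scaling down to the Nehari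
set would strictly lower `reducedAction`, so the limit already lies on it. The line is reached
through growing cells (`exists_tendsto_isNehariMinimizer`). The wave equation passes to the weak
limit `V` and gives `nehari V = 0`, while Fatou bounds its action by the limit of the periodic
actions. Conversely, for `U` on the Nehari set of the line, periodizations of `t • U` with `t > 1`
are competitors on large cells, so the limit of the least actions is at most the action of `U`.
Hence `V` is a minimizer and no mass is lost, which upgrades weak to strong convergence.
Nonconstancy compares growth: a nonzero constant critical point has size at least `η`, so its action
grows linearly in `K`, while least actions on large cells stay bounded. -/

lemma fibre_deriv_pos {S a b c p q t : ℝ} (hS : 0 < S) (hp : 2 < p) (hq : 1 < q) (hqp : q < p)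
    (ha : 0 < a) (hb : 0 ≤ b) (h : S * a + q * b - p * c = 0) (ht : 0 < t) (ht1 : t < 1) :
    0 < S * (t ^ 2 * a) + q * (t ^ q * b) - p * (t ^ p * c) := by
  have h1 : t ^ p < t ^ 2 := by
    rw [← Real.rpow_two]; exact Real.rpow_lt_rpow_of_exponent_gt ht ht1 hp
  have h2 : t ^ p ≤ t ^ q := Real.rpow_le_rpow_of_exponent_ge ht ht1.le hqp.le
  -- Subtracting `t ^ p` times the relation `h` removes `c` and leaves differences of powers whose
  -- sign depends only on whether `t < 1`.
  have e : S * (t ^ 2 * a) + q * (t ^ q * b) - p * (t ^ p * c)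
      = S * a * (t ^ 2 - t ^ p) + q * b * (t ^ q - t ^ p) + t ^ p * (S * a + q * b - p * c) := by
    ring
  rw [e, h]
  have := mul_pos (mul_pos hS ha) (sub_pos.2 h1)
  have := mul_nonneg (mul_nonneg (by linarith : (0:ℝ) ≤ q) hb) (sub_nonneg.2 h2)
  linarith

lemma fibre_deriv_neg {S a b c p q t : ℝ} (hS : 0 < S) (hp : 2 < p) (hq : 1 < q) (hqp : q < p)
    (ha : 0 < a) (hb : 0 ≤ b) (h : S * a + q * b - p * c = 0) (ht1 : 1 < t) :
    S * (t ^ 2 * a) + q * (t ^ q * b) - p * (t ^ p * c) < 0 := by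
  have h1 : t ^ 2 < t ^ p := by
    rw [← Real.rpow_two]; exact Real.rpow_lt_rpow_of_exponent_lt ht1 hp
  have h2 : t ^ q ≤ t ^ p := Real.rpow_le_rpow_of_exponent_le ht1.le hqp.le
  have e : S * (t ^ 2 * a) + q * (t ^ q * b) - p * (t ^ p * c)
      = -(S * a * (t ^ p - t ^ 2)) - q * b * (t ^ p - t ^ q)
        + t ^ p * (S * a + q * b - p * c) := by
    ring
  rw [e, h]
  have := mul_pos (mul_pos hS ha) (sub_pos.2 h1)
  have := mul_nonneg (mul_nonneg (by linarith : (0:ℝ) ≤ q) hb) (sub_nonneg.2 h2)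
  linarith

lemma continuous_fibre_deriv {S a b c p q : ℝ} (hp : 2 < p) (hq : 1 < q) :
    Continuous fun t : ℝ => S * (t ^ 2 * a) + q * (t ^ q * b) - p * (t ^ p * c) := by
  have h1 : Continuous fun t : ℝ => t ^ q := Real.continuous_rpow_const (by linarith)
  have h2 : Continuous fun t : ℝ => t ^ p := Real.continuous_rpow_const (by linarith)
  fun_prop

/-- Near `0` the quadratic term dominates `t ^ p` because `p > 2`, and the `q`-term only helps; the
intermediate value theorem then gives a zero before `t₀`. -/
lemma exists_fibre_deriv_eq_zero {S a b c p q t₀ : ℝ} (hS : 0 < S) (hp : 2 < p) (hq : 1 < q)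
    (ha : 0 < a) (hb : 0 ≤ b) (ht₀ : 0 < t₀)
    (h : S * (t₀ ^ 2 * a) + q * (t₀ ^ q * b) - p * (t₀ ^ p * c) ≤ 0) :
    ∃ t, 0 < t ∧ t ≤ t₀ ∧ S * (t ^ 2 * a) + q * (t ^ q * b) - p * (t ^ p * c) = 0 := by
  have hlim : Tendsto (fun t : ℝ => S * a - p * (t ^ (p - 2) * c)) (𝓝[>] 0)
      (𝓝 (S * a - p * (0 ^ (p - 2) * c))) := by
    have h2 : Continuous fun t : ℝ => t ^ (p - 2) := Real.continuous_rpow_const (by linarith)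
    exact (Continuous.tendsto (by fun_prop) 0).mono_left nhdsWithin_le_nhds
  rw [Real.zero_rpow (by linarith)] at hlim
  have hpos : 0 < S * a - p * (0 * c) := by simpa using mul_pos hS ha
  obtain ⟨s, hs, hs0, hst⟩ := ((hlim.eventually (lt_mem_nhds hpos)).and
    (Ioo_mem_nhdsGT ht₀)).exists
  have hs' : 0 ≤ S * (s ^ 2 * a) + q * (s ^ q * b) - p * (s ^ p * c) := by
    have e : s ^ p = s ^ 2 * s ^ (p - 2) := by
      rw [← Real.rpow_two, ← Real.rpow_add hs0]; congr 1; ring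
    have : 0 ≤ q * (s ^ q * b) := by positivity
    have : 0 ≤ s ^ 2 * (S * a - p * (s ^ (p - 2) * c)) := by positivity
    rw [e]; nlinarith
  obtain ⟨t, ht, h0⟩ := intermediate_value_Icc' hst.le
    (continuous_fibre_deriv (S := S) (a := a) (b := b) (c := c) hp hq).continuousOn ⟨h, hs'⟩
  exact ⟨t, hs0.trans_le ht.1, ht.2, h0⟩

lemma exists_fibre_deriv_neg {S a b c p q : ℝ} (hp : 2 < p) (hqp : q < p) (hc : 0 < c) :
    ∃ t, 0 < t ∧ S * (t ^ 2 * a) + q * (t ^ q * b) - p * (t ^ p * c) < 0 := by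
  have h1 : Tendsto (fun t : ℝ => t ^ (-(p - 2))) atTop (𝓝 0) :=
    tendsto_rpow_neg_atTop (by linarith)
  have h2 : Tendsto (fun t : ℝ => t ^ (-(p - q))) atTop (𝓝 0) :=
    tendsto_rpow_neg_atTop (by linarith)
  have h3 : Tendsto (fun t : ℝ => S * (t ^ (-(p - 2)) * a) + q * (t ^ (-(p - q)) * b) - p * c)
      atTop (𝓝 (S * (0 * a) + q * (0 * b) - p * c)) :=
    ((((h1.mul_const a).const_mul S).add ((h2.mul_const b).const_mul q)).sub_const _)
  have hneg : S * (0 * a) + q * (0 * b) - p * c < 0 := by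
    have : 0 < p * c := by positivity
    linarith
  obtain ⟨t, ht, ht0⟩ := ((h3.eventually (gt_mem_nhds hneg)).and (eventually_gt_atTop 0)).exists
  refine ⟨t, ht0, ?_⟩
  have e1 : t ^ 2 = t ^ p * t ^ (-(p - 2)) := by
    rw [← Real.rpow_add ht0, ← Real.rpow_two]; congr 1; ring
  have e2 : t ^ q = t ^ p * t ^ (-(p - q)) := by
    rw [← Real.rpow_add ht0]; congr 1; ring
  have hpp : 0 < t ^ p := Real.rpow_pos_of_pos ht0 _
  rw [e1, e2]
  have := mul_neg_of_pos_of_neg hpp ht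
  nlinarith

/-- Bernoulli's inequality for `t ^ p = (t ^ r) ^ (p / r)` with `r = 2` and `r = q`. Once `c` is
eliminated, the gap between the two sides is a nonnegative combination of these two Bernoulli gaps.
-/
lemma fibre_le {S a b c p q t : ℝ} (hS : 0 < S) (hp : 2 < p) (hq : 1 < q) (hqp : q < p)
    (ha : 0 ≤ a) (hb : 0 ≤ b) (h : S * a + q * b - p * c = 0) (ht : 0 < t) :
    1 / 2 * S * (t ^ 2 * a) + t ^ q * b - t ^ p * c ≤ 1 / 2 * S * a + b - c := by
  have hp0 : 0 < p := by linarith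
  have hq0 : 0 < q := by linarith
  have key : ∀ r, 0 < r → r < p → 1 + p / r * (t ^ r - 1) ≤ t ^ p := by
    intro r hr hrp
    have h0 : 0 < t ^ r := Real.rpow_pos_of_pos ht _
    have := one_add_mul_self_le_rpow_one_add (s := t ^ r - 1) (by linarith) (p := p / r)
      (by rw [le_div_iff₀ hr]; linarith)
    rwa [add_sub_cancel, ← Real.rpow_mul ht.le, mul_div_cancel₀ _ hr.ne'] at this
  have k1 := key 2 (by norm_num) hp
  rw [Real.rpow_two] at k1
  have k2 := key q hq0 hqp
  have hc : c = (S * a + q * b) / p := by field_simp; linarith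
  have k1' : 0 ≤ S * a / p * (t ^ p - (1 + p / 2 * (t ^ 2 - 1))) := by
    have := sub_nonneg.2 k1; positivity
  have k2' : 0 ≤ q * b / p * (t ^ p - (1 + p / q * (t ^ q - 1))) := by
    have := sub_nonneg.2 k2; positivity
  have e : 1 / 2 * S * a + b - c - (1 / 2 * S * (t ^ 2 * a) + t ^ q * b - t ^ p * c)
      = S * a / p * (t ^ p - (1 + p / 2 * (t ^ 2 - 1)))
        + q * b / p * (t ^ p - (1 + p / q * (t ^ q - 1))) := by
    rw [hc]; field_simp; ring
  linarith

/-! ### Functions on the periodicity cell -/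

/-- `f` is `2K`-periodic if `K` is finite; no condition for `K = ∞`. -/
def CellPeriodic (K : ℝ≥0∞) (f : ℝ → ℝ) : Prop :=
  K ≠ ∞ → Function.Periodic f (2 * K.toReal)

lemma cell_top : cell ∞ = univ := by simp [cell]

lemma cell_of_ne_top {K : ℝ≥0∞} (hK : K ≠ ∞) : cell K = Ioc (-K.toReal) K.toReal := by
  simp [cell, hK]

lemma cellMeasure_top : cellMeasure ∞ = volume := by simp [cellMeasure, cell_top]

lemma cellMeasure_of_ne_top {K : ℝ≥0∞} (hK : K ≠ ∞) :
    cellMeasure K = volume.restrict (Ioc (-K.toReal) K.toReal) := by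
  rw [cellMeasure, cell_of_ne_top hK]

lemma measurableSet_cell (K : ℝ≥0∞) : MeasurableSet (cell K) := by
  unfold cell; split_ifs
  · exact MeasurableSet.univ
  · exact measurableSet_Ioc

lemma cellMeasure_le_volume (K : ℝ≥0∞) : cellMeasure K ≤ volume := Measure.restrict_le_self

instance instSFiniteCellMeasure (K : ℝ≥0∞) : SFinite (cellMeasure K) := by
  unfold cellMeasure; infer_instance

lemma isFiniteMeasure_cellMeasure {K : ℝ≥0∞} (hK : K ≠ ∞) : IsFiniteMeasure (cellMeasure K) := by
  rw [cellMeasure_of_ne_top hK]; infer_instance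

lemma integral_cellMeasure_of_ne_top {K : ℝ≥0∞} (hK : K ≠ ∞) (f : ℝ → ℝ) :
    ∫ x, f x ∂(cellMeasure K) = ∫ x in (-K.toReal)..K.toReal, f x := by
  rw [cellMeasure_of_ne_top hK, intervalIntegral.integral_of_le]
  linarith [K.toReal_nonneg]

lemma integrable_cellMeasure_iff_of_ne_top {K : ℝ≥0∞} (hK : K ≠ ∞) (f : ℝ → ℝ) :
    Integrable f (cellMeasure K) ↔ IntervalIntegrable f volume (-K.toReal) K.toReal := by
  rw [cellMeasure_of_ne_top hK, intervalIntegrable_iff_integrableOn_Ioc_of_le, IntegrableOn]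
  linarith [K.toReal_nonneg]

namespace CellPeriodic

variable {K : ℝ≥0∞} {f g : ℝ → ℝ}

lemma comp_shift (hf : CellPeriodic K f) (s : ℝ) : CellPeriodic K fun x => f (x + s) := by
  intro hK x
  have := hf hK (x + s)
  simp only at this ⊢
  rw [← this]; congr 1; ring

lemma map (hf : CellPeriodic K f) (Θ : ℝ → ℝ) : CellPeriodic K fun x => Θ (f x) := by
  intro hK x; simp only [hf hK x]

lemma map₂ (hf : CellPeriodic K f) (hg : CellPeriodic K g) (Θ : ℝ → ℝ → ℝ) :
    CellPeriodic K fun x => Θ (f x) (g x) := by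
  intro hK x; simp only [hf hK x, hg hK x]

lemma avg (hf : CellPeriodic K f) : CellPeriodic K (avg f) := by
  intro hK φ
  simp only [GroundWaves.avg]
  have h := hf hK
  rw [show φ + 2 * K.toReal - 1 / 2 = φ - 1 / 2 + 2 * K.toReal by ring,
    show φ + 2 * K.toReal + 1 / 2 = φ + 1 / 2 + 2 * K.toReal by ring,
    ← intervalIntegral.integral_comp_add_right]
  exact intervalIntegral.integral_congr fun x _ => h x

lemma intervalIntegrable (hf : CellPeriodic K f) (hK : 0 < K)
    (hi : Integrable f (cellMeasure K)) (x y : ℝ) : IntervalIntegrable f volume x y := by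
  by_cases h : K = ∞
  · subst h; rw [cellMeasure_top] at hi; exact hi.intervalIntegrable
  · have hpos : 0 < K.toReal := ENNReal.toReal_pos hK.ne' h
    rw [integrable_cellMeasure_iff_of_ne_top h] at hi
    refine (hf h).intervalIntegrable (by positivity) (t := -K.toReal) ?_ x y
    convert hi using 1; ring

lemma integral_shift (hf : CellPeriodic K f) (s : ℝ) :
    ∫ x, f (x + s) ∂(cellMeasure K) = ∫ x, f x ∂(cellMeasure K) := by
  by_cases h : K = ∞
  · subst h; rw [cellMeasure_top]; exact integral_add_right_eq_self f s
  · rw [integral_cellMeasure_of_ne_top h, integral_cellMeasure_of_ne_top h,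
      intervalIntegral.integral_comp_add_right]
    have := (hf h).intervalIntegral_add_eq (-K.toReal + s) (-K.toReal)
    rw [show -K.toReal + s + 2 * K.toReal = K.toReal + s by ring,
      show -K.toReal + 2 * K.toReal = K.toReal by ring] at this
    exact this

lemma integrable_shift (hf : CellPeriodic K f) (hK : 0 < K) (hi : Integrable f (cellMeasure K))
    (s : ℝ) : Integrable (fun x => f (x + s)) (cellMeasure K) := by
  by_cases h : K = ∞
  · subst h; rw [cellMeasure_top] at hi ⊢; exact hi.comp_add_right s
  · rw [integrable_cellMeasure_iff_of_ne_top h]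
    have := (hf.intervalIntegrable hK hi (-K.toReal + s) (K.toReal + s)).comp_add_right s
    simpa using this

lemma aestronglyMeasurable_of_integrable (hf : CellPeriodic K f) (hK : 0 < K)
    (hi : Integrable f (cellMeasure K)) : AEStronglyMeasurable f volume := by
  refine LocallyIntegrable.aestronglyMeasurable fun x => ?_
  refine ⟨Ioc (x - 1) (x + 1), Ioc_mem_nhds (by linarith) (by linarith), ?_⟩
  exact (intervalIntegrable_iff_integrableOn_Ioc_of_le (by linarith)).1
    (hf.intervalIntegrable hK hi _ _)

/-- The integral of `|f|` over any number of periods vanishes, and finitely many periods cover each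
`(-n, n]`. This links the mass on one cell to nontriviality, which is stated on the whole line. -/
lemma ae_eq_zero_of_cell (hf : CellPeriodic K f) (hK : 0 < K) (h : f =ᵐ[cellMeasure K] 0) :
    f =ᵐ[volume] 0 := by
  by_cases hT : K = ∞
  · subst hT; rwa [cellMeasure_top] at h
  have hi : Integrable f (cellMeasure K) := (integrable_zero ℝ ℝ _).congr h.symm
  have hN : ∀ n : ℕ, ∀ᵐ x ∂(volume.restrict (Ioc (-(n : ℝ)) n)), f x = 0 := by
    intro n
    have h1 : CellPeriodic K fun x => |f x| := hf.map _
    have h1i : Integrable (fun x => |f x|) (cellMeasure K) := hi.abs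
    have hii := fun x y => h1.intervalIntegrable hK h1i x y
    have hpos : 0 < K.toReal := ENNReal.toReal_pos hK.ne' hT
    obtain ⟨m, hm⟩ := exists_nat_ge ((2 * n) / (2 * K.toReal))
    have hm' : 2 * (n : ℝ) ≤ m * (2 * K.toReal) := (div_le_iff₀ (by positivity)).1 hm
    have e := (h1 hT).intervalIntegral_add_zsmul_eq m (-(n : ℝ)) hii
    rw [(h1 hT).intervalIntegral_add_eq _ (-K.toReal),
      show -K.toReal + 2 * K.toReal = K.toReal by ring, ← integral_cellMeasure_of_ne_top hT,
      integral_congr_ae (g := fun _ => 0) (by filter_upwards [h] with x hx; simp [hx])] at e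
    simp only [integral_zero, smul_zero] at e
    have hle : -(n : ℝ) ≤ -(n : ℝ) + (m : ℤ) • (2 * K.toReal) := by
      simp; positivity
    rw [intervalIntegral.integral_eq_zero_iff_of_le_of_nonneg_ae hle
      (Eventually.of_forall fun x => abs_nonneg _) (hii _ _)] at e
    have hsub : Ioc (-(n : ℝ)) n ⊆ Ioc (-(n : ℝ)) (-(n : ℝ) + (m : ℤ) • (2 * K.toReal)) := by
      apply Ioc_subset_Ioc_right
      simp; linarith
    filter_upwards [ae_restrict_of_ae_restrict_of_subset hsub e] with x hx
    simpa using hx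
  have hU : (⋃ n : ℕ, Ioc (-(n : ℝ)) n) = univ := by
    refine eq_univ_of_forall fun x => mem_iUnion.2 ?_
    obtain ⟨n, hn⟩ := exists_nat_gt |x|
    exact ⟨n, (abs_lt.1 hn).1, (abs_lt.1 hn).2.le⟩
  have := (ae_restrict_iUnion_iff (μ := volume) (fun n : ℕ => Ioc (-(n : ℝ)) n)
    (fun x => f x = 0)).2 hN
  rwa [hU, Measure.restrict_univ] at this

end CellPeriodic

/-! ### The averaging operator -/

lemma avg_eq_integral_shift (W : ℝ → ℝ) (φ : ℝ) :
    avg W φ = ∫ s in Ioc (-(1 / 2) : ℝ) (1 / 2), W (φ + s) := by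
  rw [← intervalIntegral.integral_of_le (by norm_num), avg,
    intervalIntegral.integral_comp_add_left]
  congr 1

lemma avg_eq_integral_shift_neg (W : ℝ → ℝ) (φ : ℝ) :
    avg W φ = ∫ s in Ioc (-(1 / 2) : ℝ) (1 / 2), W (φ - s) := by
  rw [← intervalIntegral.integral_of_le (by norm_num), avg,
    intervalIntegral.integral_comp_sub_left]
  congr 1; ring

lemma avg_comp_shift (W : ℝ → ℝ) (s φ : ℝ) : avg (fun x => W (x + s)) φ = avg W (φ + s) := by
  simp only [avg]
  rw [intervalIntegral.integral_comp_add_right]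
  congr 1 <;> ring

lemma avg_smul (t : ℝ) (W : ℝ → ℝ) : avg (t • W) = fun φ => t * avg W φ := by
  ext φ; simp [avg]

lemma avg_add_smul {W V : ℝ → ℝ} (hW : ∀ x y, IntervalIntegrable W volume x y)
    (hV : ∀ x y, IntervalIntegrable V volume x y) (t φ : ℝ) :
    avg (W + t • V) φ = avg W φ + t * avg V φ := by
  simp only [avg, Pi.add_apply, Pi.smul_apply, smul_eq_mul]
  rw [intervalIntegral.integral_add (hW _ _) ((hV _ _).const_mul t),
    intervalIntegral.integral_const_mul]

lemma continuous_avg {W : ℝ → ℝ} (hW : ∀ x y, IntervalIntegrable W volume x y) :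
    Continuous (avg W) := by
  have e : avg W = fun φ => (∫ s in (0:ℝ)..(φ + 1 / 2), W s) - ∫ s in (0:ℝ)..(φ - 1 / 2), W s := by
    ext φ
    rw [intervalIntegral.integral_interval_sub_left (hW _ _) (hW _ _)]; rfl
  have h := intervalIntegral.continuous_primitive hW 0
  rw [e]
  exact (h.comp (continuous_add_const _)).sub (h.comp (continuous_id.sub continuous_const))

/-- The variance of `W` over a window of length one is nonnegative. -/
lemma sq_avg_le {W : ℝ → ℝ} (hW : ∀ x y, IntervalIntegrable W volume x y)
    (hW2 : ∀ x y, IntervalIntegrable (fun s => W s ^ 2) volume x y) (φ : ℝ) :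
    avg W φ ^ 2 ≤ avg (fun s => W s ^ 2) φ := by
  set m := avg W φ with hm
  have h0 : 0 ≤ ∫ s in (φ - 1 / 2)..(φ + 1 / 2), (W s - m) ^ 2 :=
    intervalIntegral.integral_nonneg (by linarith) fun x _ => sq_nonneg _
  have e : ∫ s in (φ - 1 / 2)..(φ + 1 / 2), (W s - m) ^ 2
      = avg (fun s => W s ^ 2) φ - 2 * m * avg W φ + m ^ 2 := by
    simp only [avg]
    rw [← intervalIntegral.integral_const_mul, ← intervalIntegral.integral_sub (hW2 _ _)
      ((hW _ _).const_mul _)]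
    have : m ^ 2 = ∫ s in (φ - 1 / 2)..(φ + 1 / 2), m ^ 2 := by
      rw [intervalIntegral.integral_const]; simp; ring
    rw [this, ← intervalIntegral.integral_add ((hW2 _ _).sub ((hW _ _).const_mul _)) (by simp)]
    congr 1; ext s; ring
  rw [e, ← hm] at h0
  nlinarith

lemma abs_avg_le_of_abs_le {f : ℝ → ℝ} {C : ℝ} (h : ∀ x, |f x| ≤ C) (φ : ℝ) : |avg f φ| ≤ C := by
  have := intervalIntegral.norm_integral_le_of_norm_le_const (a := φ - 1 / 2) (b := φ + 1 / 2)
    (f := f) (C := C) fun x _ => h x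
  refine this.trans (le_of_eq ?_)
  norm_num

/-- This justifies Fubini for averages: every slice in `x` has the same `L¹` norm on the cell by
shift invariance, and the `s`-interval is bounded. -/
lemma integrable_prod_shift {K : ℝ≥0∞} (hK : 0 < K) {V : ℝ → ℝ} (hVK : CellPeriodic K V)
    (hV : Integrable V (cellMeasure K)) :
    Integrable (fun z : ℝ × ℝ => V (z.1 + z.2))
      ((cellMeasure K).prod (volume.restrict (Ioc (-(1 / 2) : ℝ) (1 / 2)))) := by
  have hVm : AEStronglyMeasurable V volume := hVK.aestronglyMeasurable_of_integrable hK hV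
  have hm : AEStronglyMeasurable (fun z : ℝ × ℝ => V (z.1 + z.2))
      ((cellMeasure K).prod (volume.restrict (Ioc (-(1 / 2) : ℝ) (1 / 2)))) := by
    refine (hVm.comp_quasiMeasurePreserving
      (quasiMeasurePreserving_add (cellMeasure K) volume)).mono_measure ?_
    exact Measure.prod_mono le_rfl Measure.restrict_le_self
  rw [integrable_prod_iff' hm]
  refine ⟨Eventually.of_forall fun s => hVK.integrable_shift hK hV s, ?_⟩
  have : (fun s => ∫ x, ‖V (x + s)‖ ∂(cellMeasure K))
      = fun _ => ∫ x, ‖V x‖ ∂(cellMeasure K) := by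
    ext s
    exact (hVK.map (fun v => ‖v‖)).integral_shift s
  simp only [this]
  exact integrable_const _

lemma integrable_avg {K : ℝ≥0∞} (hK : 0 < K) {V : ℝ → ℝ} (hVK : CellPeriodic K V)
    (hV : Integrable V (cellMeasure K)) : Integrable (avg V) (cellMeasure K) := by
  have e : avg V = fun φ => ∫ s in Ioc (-(1 / 2) : ℝ) (1 / 2), V (φ + s) := by
    ext φ; exact avg_eq_integral_shift V φ
  rw [e]
  exact (integrable_prod_shift hK hVK hV).integral_prod_left

/-- The averaging operator is symmetric. -/
lemma integral_mul_avg {K : ℝ≥0∞} (hK : 0 < K) {G V : ℝ → ℝ} {C : ℝ} (hG : Continuous G)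
    (hGC : ∀ x, |G x| ≤ C) (hGK : CellPeriodic K G) (hVK : CellPeriodic K V)
    (hV : Integrable V (cellMeasure K)) :
    ∫ x, G x * avg V x ∂(cellMeasure K) = ∫ x, avg G x * V x ∂(cellMeasure K) := by
  set J : Set ℝ := Ioc (-(1 / 2) : ℝ) (1 / 2)
  have hVint : Integrable (fun z : ℝ × ℝ => V (z.1 + z.2))
      ((cellMeasure K).prod (volume.restrict J)) := integrable_prod_shift hK hVK hV
  have hint : Integrable (Function.uncurry fun x s => G x * V (x + s))
      ((cellMeasure K).prod (volume.restrict J)) :=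
    hVint.bdd_mul (c := C) (hG.comp continuous_fst).aestronglyMeasurable
      (Eventually.of_forall fun z => hGC z.1)
  have hint2 : Integrable (Function.uncurry fun x s => G (x - s) * V x)
      ((cellMeasure K).prod (volume.restrict J)) := by
    have : Integrable (fun z : ℝ × ℝ => V z.1) ((cellMeasure K).prod (volume.restrict J)) :=
      hV.comp_fst _
    exact this.bdd_mul (c := C)
      (hG.comp (continuous_fst.sub continuous_snd)).aestronglyMeasurable
      (Eventually.of_forall fun z => hGC _)
  calc ∫ x, G x * avg V x ∂(cellMeasure K)
      = ∫ x, (∫ s in J, G x * V (x + s)) ∂(cellMeasure K) := by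
        congr 1; ext x; rw [integral_const_mul, avg_eq_integral_shift]
    _ = ∫ s in J, ∫ x, G x * V (x + s) ∂(cellMeasure K) := integral_integral_swap hint
    _ = ∫ s in J, ∫ x, G (x - s) * V x ∂(cellMeasure K) := by
        congr 1; ext s
        -- The substitution `x ↦ x + s` is legitimate on a bounded cell because the whole product is
        -- periodic.
        have hp : CellPeriodic K fun x => G (x - s) * V x :=
          (hGK.comp_shift (-s)).map₂ hVK (· * ·)
        rw [← hp.integral_shift s]; simp
    _ = ∫ x, (∫ s in J, G (x - s) * V x) ∂(cellMeasure K) := (integral_integral_swap hint2).symm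
    _ = _ := by
        congr 1; ext x; rw [integral_mul_const, avg_eq_integral_shift_neg]

/-- Symmetry of `avg` tested with the constant `1`, which averages to itself and is admissible even
on the line because `V` is integrable. -/
lemma integral_avg {K : ℝ≥0∞} (hK : 0 < K) {V : ℝ → ℝ} (hVK : CellPeriodic K V)
    (hV : Integrable V (cellMeasure K)) :
    ∫ x, avg V x ∂(cellMeasure K) = ∫ x, V x ∂(cellMeasure K) := by
  have h := integral_mul_avg hK (G := fun _ => 1) (C := 1) continuous_const (by simp)
    (fun _ _ => rfl) hVK hV
  have e : avg (fun _ => 1) = fun _ => 1 := by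
    ext φ; simp [avg]; norm_num
  simpa [e] using h

/-! ### Square integrable functions on the cell and bounds for their averages. -/

/-- `∫_{I_K} W² dφ`. -/
def mass (K : ℝ≥0∞) (W : ℝ → ℝ) : ℝ := ∫ φ, W φ ^ 2 ∂(cellMeasure K)

/-- Cell-periodic functions that are square integrable on the cell. -/
structure CellL2 (K : ℝ≥0∞) (W : ℝ → ℝ) : Prop where
  periodic : CellPeriodic K W
  memLp : MemLp W 2 (cellMeasure K)

lemma mass_nonneg (K : ℝ≥0∞) (W : ℝ → ℝ) : 0 ≤ mass K W := integral_nonneg fun _ => sq_nonneg _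

lemma potentialPart_nonneg (r : ℝ) (K : ℝ≥0∞) (W : ℝ → ℝ) : 0 ≤ potentialPart r K W :=
  integral_nonneg fun _ => by positivity

namespace CellL2

variable {K : ℝ≥0∞} {W V : ℝ → ℝ}

lemma integrable_sq (hW : CellL2 K W) : Integrable (fun s => W s ^ 2) (cellMeasure K) :=
  hW.memLp.integrable_sq

lemma intervalIntegrable (hW : CellL2 K W) (hK : 0 < K) (x y : ℝ) :
    IntervalIntegrable W volume x y := by
  by_cases h : K = ∞
  · subst h
    have hm := hW.memLp
    rw [cellMeasure_top] at hm
    exact ((hm.locallyIntegrable (by norm_num)).integrableOn_isCompact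
      isCompact_uIcc).intervalIntegrable
  · have := isFiniteMeasure_cellMeasure h
    exact hW.periodic.intervalIntegrable hK (hW.memLp.integrable (by norm_num)) x y

lemma intervalIntegrable_sq (hW : CellL2 K W) (hK : 0 < K) (x y : ℝ) :
    IntervalIntegrable (fun s => W s ^ 2) volume x y :=
  (hW.periodic.map (· ^ 2)).intervalIntegrable hK hW.integrable_sq x y

lemma aestronglyMeasurable (hW : CellL2 K W) (hK : 0 < K) : AEStronglyMeasurable W volume := by
  refine LocallyIntegrable.aestronglyMeasurable fun x => ?_
  refine ⟨Ioc (x - 1) (x + 1), Ioc_mem_nhds (by linarith) (by linarith), ?_⟩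
  exact (intervalIntegrable_iff_integrableOn_Ioc_of_le (by linarith)).1
    (hW.intervalIntegrable hK _ _)

lemma add_smul (hW : CellL2 K W) (hV : CellL2 K V) (t : ℝ) : CellL2 K (W + t • V) :=
  ⟨hW.periodic.map₂ hV.periodic fun w v => w + t * v, hW.memLp.add (hV.memLp.const_smul t)⟩

lemma shift (hW : CellL2 K W) (hK : 0 < K) (s : ℝ) : CellL2 K fun x => W (x + s) := by
  refine ⟨hW.periodic.comp_shift s, ?_⟩
  have hm : AEStronglyMeasurable (fun x => W (x + s)) volume :=
    (hW.aestronglyMeasurable hK).comp_quasiMeasurePreserving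
      (measurePreserving_add_right volume s).quasiMeasurePreserving
  rw [memLp_two_iff_integrable_sq (hm.mono_measure (cellMeasure_le_volume K))]
  exact (hW.periodic.map (· ^ 2)).integrable_shift hK hW.integrable_sq s

lemma continuous_avg (hW : CellL2 K W) (hK : 0 < K) : Continuous (avg W) :=
  GroundWaves.continuous_avg (hW.intervalIntegrable hK)

lemma sq_avg_le (hW : CellL2 K W) (hK : 0 < K) (φ : ℝ) :
    avg W φ ^ 2 ≤ avg (fun s => W s ^ 2) φ :=
  GroundWaves.sq_avg_le (hW.intervalIntegrable hK) (hW.intervalIntegrable_sq hK) φ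

lemma integrable_avg_sq (hW : CellL2 K W) (hK : 0 < K) :
    Integrable (fun φ => avg W φ ^ 2) (cellMeasure K) := by
  refine (integrable_avg hK (hW.periodic.map (· ^ 2)) hW.integrable_sq).mono'
    ((hW.continuous_avg hK).pow 2).aestronglyMeasurable (Eventually.of_forall fun φ => ?_)
  rw [Real.norm_of_nonneg (sq_nonneg _)]
  exact hW.sq_avg_le hK φ

lemma integral_avg_sq_le (hW : CellL2 K W) (hK : 0 < K) :
    ∫ φ, avg W φ ^ 2 ∂(cellMeasure K) ≤ mass K W := by
  rw [mass, ← integral_avg hK (hW.periodic.map (· ^ 2)) hW.integrable_sq]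
  exact integral_mono (hW.integrable_avg_sq hK)
    (integrable_avg hK (hW.periodic.map (· ^ 2)) hW.integrable_sq) (hW.sq_avg_le hK)

/-- `N` is a number of periods long enough to cover a window of length one. Short cells need
several; on the line and on cells of length at least one, `N = 1` gives a bound independent of `K`.
-/
lemma avg_sq_le_mass (hW : CellL2 K W) (hK : 0 < K) {N : ℕ} (hN : 1 ≤ N)
    (hNK : K ≠ ∞ → 1 ≤ N * (2 * K.toReal)) (φ : ℝ) :
    avg (fun s => W s ^ 2) φ ≤ N * mass K W := by
  have hii := hW.intervalIntegrable_sq hK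
  by_cases h : K = ∞
  · subst h
    have h1 : avg (fun s => W s ^ 2) φ ≤ mass ∞ W := by
      rw [avg, intervalIntegral.integral_of_le (by linarith), mass, cellMeasure_top]
      have := hW.integrable_sq
      rw [cellMeasure_top] at this
      exact setIntegral_le_integral this (Eventually.of_forall fun _ => sq_nonneg _)
    have h2 : (1 : ℝ) ≤ N := by exact_mod_cast hN
    nlinarith [mass_nonneg ∞ W]
  · have hN' := hNK h
    have hp := hW.periodic.map (· ^ 2) h
    have e := hp.intervalIntegral_add_zsmul_eq N (φ - 1 / 2) hii
    rw [hp.intervalIntegral_add_eq _ (-K.toReal),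
      show -K.toReal + 2 * K.toReal = K.toReal by ring, ← integral_cellMeasure_of_ne_top h] at e
    have e2 : (N : ℝ) * mass K W
        = ∫ x in (φ - 1 / 2)..(φ - 1 / 2 + (N : ℤ) • (2 * K.toReal)), W x ^ 2 := by
      rw [e]; simp [mass]
    rw [e2, avg]
    refine intervalIntegral.integral_mono_interval le_rfl (by linarith) ?_
      (Eventually.of_forall fun _ => sq_nonneg _) (hii _ _)
    simp only [zsmul_eq_mul, Int.cast_natCast]; linarith

lemma abs_avg_le (hW : CellL2 K W) (hK : 0 < K) {N : ℕ} (hN : 1 ≤ N)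
    (hNK : K ≠ ∞ → 1 ≤ N * (2 * K.toReal)) (φ : ℝ) :
    |avg W φ| ≤ √(N * mass K W) :=
  Real.abs_le_sqrt ((hW.sq_avg_le hK φ).trans (hW.avg_sq_le_mass hK hN hNK φ))

end CellL2

lemma abs_rpow_le_mul_sq {w S r : ℝ} (hr : 2 ≤ r) (hS : |w| ≤ S) :
    |w| ^ r ≤ S ^ (r - 2) * w ^ 2 := by
  have hS0 := (abs_nonneg _).trans hS
  rcases (abs_nonneg w).eq_or_lt with h | h
  · rw [← h, Real.zero_rpow (by linarith)]
    positivity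
  · have e : |w| ^ r = |w| ^ (r - 2) * w ^ 2 := by
      rw [← sq_abs, ← Real.rpow_two, ← Real.rpow_add h]; congr 1; ring
    rw [e]
    gcongr

lemma exists_nat_cover {K : ℝ≥0∞} (hK : 0 < K) :
    ∃ N : ℕ, 1 ≤ N ∧ (K ≠ ∞ → 1 ≤ N * (2 * K.toReal)) := by
  by_cases h : K = ∞
  · exact ⟨1, le_rfl, fun h' => absurd h h'⟩
  · have hpos : 0 < K.toReal := ENNReal.toReal_pos hK.ne' h
    obtain ⟨N, hN⟩ := exists_nat_ge (1 / (2 * K.toReal))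
    refine ⟨N + 1, by omega, fun _ => ?_⟩
    rw [div_le_iff₀ (by positivity)] at hN
    push_cast; nlinarith

namespace CellL2

variable {K : ℝ≥0∞} {W V : ℝ → ℝ}

lemma exists_abs_avg_le (hW : CellL2 K W) (hK : 0 < K) : ∃ C, 0 ≤ C ∧ ∀ φ, |avg W φ| ≤ C := by
  obtain ⟨N, hN, hNK⟩ := exists_nat_cover hK
  exact ⟨_, Real.sqrt_nonneg _, hW.abs_avg_le hK hN hNK⟩

lemma continuous_abs_avg_rpow (hW : CellL2 K W) (hK : 0 < K) {r : ℝ} (hr : 0 ≤ r) :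
    Continuous fun φ => |avg W φ| ^ r :=
  (hW.continuous_avg hK).abs.rpow_const fun _ => Or.inr hr

lemma integrable_abs_avg_rpow (hW : CellL2 K W) (hK : 0 < K) {r : ℝ} (hr : 2 ≤ r) :
    Integrable (fun φ => |avg W φ| ^ r) (cellMeasure K) := by
  obtain ⟨C, -, hC⟩ := hW.exists_abs_avg_le hK
  refine ((hW.integrable_avg_sq hK).const_mul (C ^ (r - 2))).mono'
    (hW.continuous_abs_avg_rpow hK (by linarith)).aestronglyMeasurable
    (Eventually.of_forall fun φ => ?_)
  rw [Real.norm_of_nonneg (by positivity)]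
  exact abs_rpow_le_mul_sq hr (hC φ)

lemma integrable_abs_avg_rpow_of_ne_top (hW : CellL2 K W) (hK : 0 < K) (hT : K ≠ ∞) {r : ℝ}
    (hr : 0 ≤ r) : Integrable (fun φ => |avg W φ| ^ r) (cellMeasure K) := by
  have := isFiniteMeasure_cellMeasure hT
  obtain ⟨C, -, hC⟩ := hW.exists_abs_avg_le hK
  refine (integrable_const (C ^ r)).mono'
    (hW.continuous_abs_avg_rpow hK hr).aestronglyMeasurable (Eventually.of_forall fun φ => ?_)
  rw [Real.norm_of_nonneg (by positivity)]
  exact Real.rpow_le_rpow (abs_nonneg _) (hC φ) hr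

lemma memLp_avg_iff (hW : CellL2 K W) (hK : 0 < K) {r : ℝ} (hr : 0 < r) :
    MemLp (avg W) (ENNReal.ofReal r) (cellMeasure K) ↔
      Integrable (fun φ => |avg W φ| ^ r) (cellMeasure K) := by
  rw [← integrable_norm_rpow_iff (hW.continuous_avg hK).aestronglyMeasurable
    (by simpa using hr) ENNReal.ofReal_ne_top, ENNReal.toReal_ofReal hr.le]
  rfl

/-- Interpolation between the sup bound and `L²`. It shows that uniformly small averages make the
`p`-part negligible against the mass. -/
lemma potentialPart_le (hW : CellL2 K W) (hK : 0 < K) {S r : ℝ} (hr : 2 ≤ r)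
    (hS : ∀ φ, |avg W φ| ≤ S) : potentialPart r K W ≤ S ^ (r - 2) * mass K W := by
  have hS0 : 0 ≤ S := (abs_nonneg _).trans (hS 0)
  calc potentialPart r K W ≤ ∫ φ, S ^ (r - 2) * avg W φ ^ 2 ∂(cellMeasure K) :=
        integral_mono (hW.integrable_abs_avg_rpow hK hr)
          ((hW.integrable_avg_sq hK).const_mul _) fun φ => abs_rpow_le_mul_sq hr (hS φ)
    _ ≤ _ := by
        rw [integral_const_mul]
        exact mul_le_mul_of_nonneg_left (hW.integral_avg_sq_le hK) (by positivity)

lemma ae_eq_zero_iff (hW : CellL2 K W) (hK : 0 < K) : W =ᵐ[volume] 0 ↔ mass K W = 0 := by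
  have h := integral_eq_zero_iff_of_nonneg (fun x => sq_nonneg (W x)) hW.integrable_sq
  rw [mass, h]
  constructor
  · intro h0
    filter_upwards [Measure.absolutelyContinuous_of_le (cellMeasure_le_volume K) h0] with x hx
    simp [hx]
  · intro h0
    refine hW.periodic.ae_eq_zero_of_cell hK ?_
    filter_upwards [h0] with x hx
    simpa using hx

end CellL2

/-- The `L^p` condition is automatic since averages of `L²` functions are bounded and square
integrable and `p > 2`. The `L^q` condition remains, because `q < 2` is allowed. -/
lemma mem_ansatz_iff {p q : ℝ} {K : ℝ≥0∞} {W : ℝ → ℝ} (hp : 2 < p) (hq : 1 < q) (hK : 0 < K) :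
    W ∈ ansatz p q K ↔
      CellL2 K W ∧ Integrable (fun φ => |avg W φ| ^ q) (cellMeasure K) := by
  constructor
  · rintro ⟨h1, h2, h3, -⟩
    exact ⟨⟨h1, h2⟩, ((CellL2.mk h1 h2).memLp_avg_iff hK (by linarith)).1 h3⟩
  · rintro ⟨h, hi⟩
    exact ⟨h.periodic, h.memLp, (h.memLp_avg_iff hK (by linarith)).2 hi,
      (h.memLp_avg_iff hK (by linarith)).2 (h.integrable_abs_avg_rpow hK hp.le)⟩

lemma mem_ansatz_of_ne_top {p q : ℝ} {K : ℝ≥0∞} {W : ℝ → ℝ} (hp : 2 < p) (hq : 1 < q) (hK : 0 < K)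
    (hT : K ≠ ∞) (hW : CellL2 K W) : W ∈ ansatz p q K :=
  (mem_ansatz_iff hp hq hK).2 ⟨hW, hW.integrable_abs_avg_rpow_of_ne_top hK hT (by linarith)⟩

lemma add_smul_mem_ansatz {p q : ℝ} {K : ℝ≥0∞} {W V : ℝ → ℝ} (hp : 2 < p) (hq : 1 < q)
    (hK : 0 < K) (hW : W ∈ ansatz p q K) (hV : V ∈ ansatz p q K) (t : ℝ) :
    W + t • V ∈ ansatz p q K := by
  have hW' := ((mem_ansatz_iff hp hq hK).1 hW).1
  have hV' := ((mem_ansatz_iff hp hq hK).1 hV).1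
  have h := hW'.add_smul hV' t
  have e : avg (W + t • V) = avg W + t • avg V := by
    ext φ
    exact avg_add_smul (hW'.intervalIntegrable hK) (hV'.intervalIntegrable hK) t φ
  refine ⟨h.periodic, h.memLp, ?_, ?_⟩ <;> rw [e]
  · exact hW.2.2.1.add (hV.2.2.1.const_smul t)
  · exact hW.2.2.2.add (hV.2.2.2.const_smul t)

lemma smul_mem_ansatz {p q : ℝ} {K : ℝ≥0∞} {W : ℝ → ℝ} (hW : W ∈ ansatz p q K) (t : ℝ) :
    t • W ∈ ansatz p q K := by
  have e : avg (t • W) = t • avg W := avg_smul t W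
  refine ⟨fun hK x => ?_, hW.2.1.const_smul t, ?_, ?_⟩
  · simp [hW.1 hK x]
  · rw [e]; exact hW.2.2.1.const_smul t
  · rw [e]; exact hW.2.2.2.const_smul t

lemma mass_smul (K : ℝ≥0∞) (t : ℝ) (W : ℝ → ℝ) : mass K (t • W) = t ^ 2 * mass K W := by
  simp only [mass, Pi.smul_apply, smul_eq_mul, mul_pow]
  rw [integral_const_mul]

lemma potentialPart_smul (r : ℝ) (K : ℝ≥0∞) {t : ℝ} (ht : 0 ≤ t) (W : ℝ → ℝ) :
    potentialPart r K (t • W) = t ^ r * potentialPart r K W := by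
  simp only [potentialPart, avg_smul, abs_mul, abs_of_nonneg ht]
  rw [← integral_const_mul]
  congr 1; ext φ
  rw [Real.mul_rpow ht (abs_nonneg _)]

lemma mass_shift {K : ℝ≥0∞} {W : ℝ → ℝ} (hW : CellPeriodic K W) (s : ℝ) :
    mass K (fun x => W (x + s)) = mass K W :=
  (hW.map (· ^ 2)).integral_shift s

lemma potentialPart_shift {K : ℝ≥0∞} {W : ℝ → ℝ} (hW : CellPeriodic K W) (r s : ℝ) :
    potentialPart r K (fun x => W (x + s)) = potentialPart r K W := by
  simp only [potentialPart, avg_comp_shift]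
  exact (hW.avg.map (fun w => |w| ^ r)).integral_shift s

lemma shift_mem_ansatz {p q : ℝ} {K : ℝ≥0∞} {W : ℝ → ℝ} (hp : 2 < p) (hq : 1 < q) (hK : 0 < K)
    (hW : W ∈ ansatz p q K) (s : ℝ) : (fun x => W (x + s)) ∈ ansatz p q K := by
  rw [mem_ansatz_iff hp hq hK] at hW ⊢
  refine ⟨hW.1.shift hK s, ?_⟩
  simp only [avg_comp_shift]
  exact (hW.1.periodic.avg.map (fun w => |w| ^ q)).integrable_shift hK hW.2 s

/-! ### Derivatives of the action -/

/-- The form in which `hasDerivAt_abs_rpow` delivers the derivative. At `w = 0` the last factor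
absorbs whatever value the power takes when `r ≤ 2`. -/
lemma Psi_eq (r w : ℝ) : Psi r w = r * |w| ^ (r - 2) * w := by
  unfold Psi
  rcases lt_trichotomy w 0 with h | h | h
  · have h' : 0 < |w| := abs_pos.2 h.ne
    have e : |w| ^ (r - 1) = |w| ^ (r - 2) * |w| := by
      conv_rhs => rw [← Real.rpow_one |w|, ← Real.rpow_mul h'.le, one_mul, ← Real.rpow_add h']
      congr 1; ring
    rw [e, Real.sign_of_neg h, abs_of_neg h]; ring
  · simp [h]
  · have h' : 0 < |w| := abs_pos.2 h.ne'
    have e : |w| ^ (r - 1) = |w| ^ (r - 2) * |w| := by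
      conv_rhs => rw [← Real.rpow_one |w|, ← Real.rpow_mul h'.le, one_mul, ← Real.rpow_add h']
      congr 1; ring
    rw [e, Real.sign_of_pos h, abs_of_pos h]; ring

lemma Psi_mul_self {r : ℝ} (hr : 1 < r) (w : ℝ) : Psi r w * w = r * |w| ^ r := by
  rw [Psi_eq]
  rcases (abs_nonneg w).eq_or_lt with h | h
  · have : w = 0 := by simpa using h.symm
    simp [this, Real.zero_rpow (by linarith : r ≠ 0)]
  · have e : |w| ^ r = |w| ^ (r - 2) * w ^ 2 := by
      rw [← sq_abs, ← Real.rpow_two, ← Real.rpow_add h]; congr 1; ring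
    rw [e]; ring

lemma continuous_Psi {r : ℝ} (hr : 1 < r) : Continuous (Psi r) := by
  -- Splitting into positive and negative parts leaves only powers with exponent `r - 1 > 0`, which
  -- are continuous at `0` even for `r < 2`.
  have e : Psi r = fun w => r * (max w 0) ^ (r - 1) - r * (max (-w) 0) ^ (r - 1) := by
    ext w
    unfold Psi
    have h0 : (0 : ℝ) ^ (r - 1) = 0 := Real.zero_rpow (by linarith)
    rcases lt_trichotomy w 0 with h | h | h
    · rw [Real.sign_of_neg h, abs_of_neg h, max_eq_right h.le, max_eq_left (by linarith), h0]
      ring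
    · simp [h]
    · rw [Real.sign_of_pos h, abs_of_pos h, max_eq_left h.le, max_eq_right (by linarith), h0]
      ring
  rw [e]
  have h := Real.continuous_rpow_const (q := r - 1) (by linarith)
  exact ((h.comp (continuous_id.max continuous_const)).const_mul r).sub
    ((h.comp (continuous_neg.max continuous_const)).const_mul r)

lemma abs_Psi {r : ℝ} (hr : 1 < r) (w : ℝ) : |Psi r w| = r * |w| ^ (r - 1) := by
  unfold Psi
  have h0 : (0 : ℝ) ^ (r - 1) = 0 := Real.zero_rpow (by linarith)
  rw [abs_mul, abs_mul, abs_of_pos (by linarith : 0 < r),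
    abs_of_nonneg (by positivity : 0 ≤ |w| ^ (r - 1))]
  rcases lt_trichotomy w 0 with h | h | h
  · rw [Real.sign_of_neg h]; simp
  · simp [h, h0]
  · rw [Real.sign_of_pos h]; simp

/-- Differentiation under the integral: for `|t| ≤ 1` the derivative is dominated by `r (|avg W| +
|avg V|)^r`, integrable because both averages are in `L^r`. -/
lemma hasDerivAt_potentialPart {r : ℝ} (hr : 1 < r) {K : ℝ≥0∞} (hK : 0 < K) {W V : ℝ → ℝ}
    (hW : CellL2 K W) (hV : CellL2 K V)
    (hWr : MemLp (avg W) (ENNReal.ofReal r) (cellMeasure K))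
    (hVr : MemLp (avg V) (ENNReal.ofReal r) (cellMeasure K)) :
    Integrable (fun φ => Psi r (avg W φ) * avg V φ) (cellMeasure K) ∧
    HasDerivAt (fun t : ℝ => potentialPart r K (W + t • V))
      (∫ φ, Psi r (avg W φ) * avg V φ ∂(cellMeasure K)) 0 := by
  have hWc := hW.continuous_avg hK
  have hVc := hV.continuous_avg hK
  have e : (fun t : ℝ => potentialPart r K (W + t • V))
      = fun t => ∫ φ, |avg W φ + t * avg V φ| ^ r ∂(cellMeasure K) := by
    ext t
    simp only [potentialPart]
    congr 1; ext φ
    rw [avg_add_smul (hW.intervalIntegrable hK) (hV.intervalIntegrable hK)]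
  rw [e]
  have hbound : Integrable (fun φ => r * (|avg W φ| + |avg V φ|) ^ r) (cellMeasure K) := by
    have h1 : MemLp (fun φ => |avg W φ| + |avg V φ|) (ENNReal.ofReal r) (cellMeasure K) :=
      hWr.norm.add hVr.norm
    have h2 := h1.integrable_norm_rpow (by simp; linarith) ENNReal.ofReal_ne_top
    rw [ENNReal.toReal_ofReal (by linarith)] at h2
    refine (h2.congr (Eventually.of_forall fun φ => ?_)).const_mul r
    simp only
    rw [Real.norm_of_nonneg (by positivity)]
  have hF0 : Integrable (fun φ => |avg W φ + 0 * avg V φ| ^ r) (cellMeasure K) := by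
    simpa using (hW.memLp_avg_iff hK (by linarith)).1 hWr
  have := hasDerivAt_integral_of_dominated_loc_of_deriv_le (μ := cellMeasure K) (x₀ := (0 : ℝ))
    (F := fun t φ => |avg W φ + t * avg V φ| ^ r)
    (F' := fun t φ => Psi r (avg W φ + t * avg V φ) * avg V φ)
    (bound := fun φ => r * (|avg W φ| + |avg V φ|) ^ r)
    (Metric.ball_mem_nhds (0 : ℝ) one_pos)
    (Eventually.of_forall fun t => ((hWc.add (hVc.const_mul t)).abs.rpow_const
      fun _ => Or.inr (by linarith)).aestronglyMeasurable)
    hF0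
    (((continuous_Psi hr).comp (hWc.add (hVc.const_mul 0))).mul hVc).aestronglyMeasurable
    (Eventually.of_forall fun φ t ht => ?_) hbound
    (Eventually.of_forall fun φ t _ => ?_)
  · simpa using this
  · have ht' : |t| ≤ 1 := by
      have := Metric.mem_ball.1 ht
      rw [dist_zero_right, Real.norm_eq_abs] at this
      exact this.le
    rw [Real.norm_eq_abs, abs_mul, abs_Psi hr]
    set u := |avg W φ|
    set v := |avg V φ|
    have hu : 0 ≤ u := abs_nonneg _
    have hv : 0 ≤ v := abs_nonneg _
    have h1 : |avg W φ + t * avg V φ| ≤ u + v := by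
      refine (abs_add_le _ _).trans ?_
      rw [abs_mul]
      have : |t| * |avg V φ| ≤ 1 * |avg V φ| := mul_le_mul_of_nonneg_right ht' hv
      linarith
    have h2 : |avg W φ + t * avg V φ| ^ (r - 1) ≤ (u + v) ^ (r - 1) :=
      Real.rpow_le_rpow (abs_nonneg _) h1 (by linarith)
    have h3 : (u + v) ^ (r - 1) * (u + v) = (u + v) ^ r := by
      rcases (add_nonneg hu hv).eq_or_lt with h | h
      · rw [← h, mul_zero, Real.zero_rpow (by linarith)]
      · conv_lhs => rw [← Real.rpow_one (u + v), ← Real.rpow_mul h.le, one_mul,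
          ← Real.rpow_add h]
        congr 1; ring
    rw [← h3, mul_assoc]
    gcongr
    linarith
  · have h1 : HasDerivAt (fun t => avg W φ + t * avg V φ) (avg V φ) t := by
      simpa using ((hasDerivAt_id t).mul_const (avg V φ)).const_add (avg W φ)
    have h2 := (hasDerivAt_abs_rpow (avg W φ + t * avg V φ) hr).comp t h1
    rw [← Psi_eq] at h2
    exact h2

lemma hasDerivAt_mass {K : ℝ≥0∞} {W V : ℝ → ℝ} (hW : CellL2 K W) (hV : CellL2 K V) :
    HasDerivAt (fun t : ℝ => mass K (W + t • V)) (2 * ∫ φ, W φ * V φ ∂(cellMeasure K)) 0 := by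
  have hWV : Integrable (fun φ => W φ * V φ) (cellMeasure K) := hW.memLp.integrable_mul hV.memLp
  have e : (fun t : ℝ => mass K (W + t • V))
      = fun t => mass K W + t * (2 * ∫ φ, W φ * V φ ∂(cellMeasure K)) + t ^ 2 * mass K V := by
    ext t
    simp only [mass]
    have hi : Integrable (fun φ => W φ ^ 2 + t * (2 * (W φ * V φ))) (cellMeasure K) :=
      hW.integrable_sq.add ((hWV.const_mul 2).const_mul t)
    rw [← integral_const_mul, ← integral_const_mul, ← integral_const_mul,
      ← integral_add hW.integrable_sq ((hWV.const_mul 2).const_mul t),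
      ← integral_add hi (hV.integrable_sq.const_mul _)]
    congr 1; ext φ
    simp only [Pi.add_apply, Pi.smul_apply, smul_eq_mul]; ring
  rw [e]
  have h1 := (((hasDerivAt_id (0:ℝ)).mul_const (2 * ∫ φ, W φ * V φ ∂(cellMeasure K))).const_add
    (mass K W)).add (((hasDerivAt_id (0:ℝ)).pow 2).mul_const (mass K V))
  convert! h1 using 1
  simp

lemma hasDerivAt_action {σ p q : ℝ} (hp : 2 < p) (hq : 1 < q) {K : ℝ≥0∞} (hK : 0 < K)
    {W V : ℝ → ℝ} (hW : W ∈ ansatz p q K) (hV : V ∈ ansatz p q K) :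
    HasDerivAt (fun t : ℝ => action σ p q K (W + t • V))
      (σ ^ 2 * ∫ φ, W φ * V φ ∂(cellMeasure K)
        + ∫ φ, Psi q (avg W φ) * avg V φ ∂(cellMeasure K)
        - ∫ φ, Psi p (avg W φ) * avg V φ ∂(cellMeasure K)) 0 := by
  have hW' := ((mem_ansatz_iff hp hq hK).1 hW).1
  have hV' := ((mem_ansatz_iff hp hq hK).1 hV).1
  have h1 := (hasDerivAt_mass hW' hV').const_mul (1 / 2 * σ ^ 2)
  have h2 := (hasDerivAt_potentialPart hq hK hW' hV' hW.2.2.1 hV.2.2.1).2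
  have h3 := (hasDerivAt_potentialPart (by linarith : 1 < p) hK hW' hV' hW.2.2.2 hV.2.2.2).2
  convert! (h1.add h2).sub h3 using 1
  ring

/-- The Euler-Lagrange equation of a critical point in weak form. -/
lemma ActionCritical.weak_eq {σ p q : ℝ} (hp : 2 < p) (hq : 1 < q) {K : ℝ≥0∞} (hK : 0 < K)
    {W V : ℝ → ℝ} (hc : ActionCritical σ p q K W) (hW : W ∈ ansatz p q K)
    (hV : V ∈ ansatz p q K) :
    σ ^ 2 * ∫ φ, W φ * V φ ∂(cellMeasure K)
        + ∫ φ, Psi q (avg W φ) * avg V φ ∂(cellMeasure K)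
        - ∫ φ, Psi p (avg W φ) * avg V φ ∂(cellMeasure K) = 0 :=
  (hasDerivAt_action hp hq hK hW hV).unique (hc V hV)

/-! ### The Nehari functional -/

/-- The derivative of the action at `W` in the direction `W`. -/
def nehari (σ p q : ℝ) (K : ℝ≥0∞) (W : ℝ → ℝ) : ℝ :=
  σ ^ 2 * mass K W + q * potentialPart q K W - p * potentialPart p K W

/-- The value of the action on the zero set of `nehari`. -/
def reducedAction (σ p q : ℝ) (K : ℝ≥0∞) (W : ℝ → ℝ) : ℝ :=
  σ ^ 2 * (1 / 2 - 1 / p) * mass K W + (1 - q / p) * potentialPart q K W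

/-- Minimizers of the action on the Nehari manifold. -/
structure IsNehariMinimizer (σ p q : ℝ) (K : ℝ≥0∞) (W : ℝ → ℝ) : Prop where
  mem : W ∈ ansatz p q K
  mass_pos : 0 < mass K W
  nehari_eq : nehari σ p q K W = 0
  le : ∀ U ∈ ansatz p q K, 0 < mass K U → nehari σ p q K U = 0 →
    reducedAction σ p q K W ≤ reducedAction σ p q K U

lemma action_eq_reducedAction {σ p q : ℝ} (hp : 2 < p) {K : ℝ≥0∞} {W : ℝ → ℝ}
    (h : nehari σ p q K W = 0) : action σ p q K W = reducedAction σ p q K W := by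
  have hp0 : p ≠ 0 := by linarith
  have hc : potentialPart p K W = (σ ^ 2 * mass K W + q * potentialPart q K W) / p := by
    unfold nehari at h
    field_simp; linarith
  change 1 / 2 * σ ^ 2 * mass K W + potentialPart q K W - potentialPart p K W = _
  rw [hc, reducedAction]; field_simp; ring

lemma reducedAction_nonneg {σ p q : ℝ} (hp : 2 < p) (hqp : q < p) (K : ℝ≥0∞) (W : ℝ → ℝ) :
    0 ≤ reducedAction σ p q K W := by
  have h1 : 0 ≤ 1 / 2 - 1 / p := by
    rw [sub_nonneg, div_le_div_iff₀ (by linarith) (by norm_num)]; linarith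
  have h2 : 0 ≤ 1 - q / p := by
    rw [sub_nonneg, div_le_one (by linarith)]; linarith
  have := mass_nonneg K W
  have := potentialPart_nonneg q K W
  unfold reducedAction; positivity

lemma reducedAction_pos {σ p q : ℝ} (hσ : 0 < σ ^ 2) (hp : 2 < p) (hqp : q < p) {K : ℝ≥0∞}
    {W : ℝ → ℝ} (hm : 0 < mass K W) : 0 < reducedAction σ p q K W := by
  have h1 : 0 < 1 / 2 - 1 / p := by
    rw [sub_pos, div_lt_div_iff₀ (by linarith) (by norm_num)]; linarith
  have h2 : 0 ≤ 1 - q / p := by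
    rw [sub_nonneg, div_le_one (by linarith)]; linarith
  have := potentialPart_nonneg q K W
  unfold reducedAction; positivity

lemma nehari_smul (σ p q : ℝ) (K : ℝ≥0∞) {t : ℝ} (ht : 0 ≤ t) (W : ℝ → ℝ) :
    nehari σ p q K (t • W) = σ ^ 2 * (t ^ 2 * mass K W) + q * (t ^ q * potentialPart q K W)
      - p * (t ^ p * potentialPart p K W) := by
  rw [nehari, mass_smul, potentialPart_smul _ _ ht, potentialPart_smul _ _ ht]

lemma reducedAction_smul_le {σ p q t : ℝ} (hp : 2 < p) (hq : 1 < q) (hqp : q < p) (K : ℝ≥0∞)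
    (W : ℝ → ℝ) (ht : 0 ≤ t) (ht1 : t ≤ 1) :
    reducedAction σ p q K (t • W) ≤ reducedAction σ p q K W := by
  have h1 : 0 ≤ 1 / 2 - 1 / p := by
    rw [sub_nonneg, div_le_div_iff₀ (by linarith) (by norm_num)]; linarith
  have h2 : 0 ≤ 1 - q / p := by
    rw [sub_nonneg, div_le_one (by linarith)]; linarith
  have h3 := mass_nonneg K W
  have h4 := potentialPart_nonneg q K W
  unfold reducedAction
  rw [mass_smul, potentialPart_smul _ _ ht]
  have h5 : t ^ 2 * mass K W ≤ mass K W := mul_le_of_le_one_left h3 (pow_le_one₀ ht ht1)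
  have h6 : t ^ q * potentialPart q K W ≤ potentialPart q K W :=
    mul_le_of_le_one_left h4 (Real.rpow_le_one ht ht1 (by linarith))
  gcongr

lemma exists_smul_nehari_eq_zero {σ p q : ℝ} (hσ : 0 < σ ^ 2) (hp : 2 < p) (hq : 1 < q)
    {K : ℝ≥0∞} {W : ℝ → ℝ} (hm : 0 < mass K W) (hn : nehari σ p q K W ≤ 0) :
    ∃ t : ℝ, 0 < t ∧ t ≤ 1 ∧ nehari σ p q K (t • W) = 0 := by
  obtain ⟨t, h0, h1, h⟩ := exists_fibre_deriv_eq_zero (S := σ ^ 2) (a := mass K W)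
    (b := potentialPart q K W) (c := potentialPart p K W) (t₀ := 1) hσ hp hq hm
    (potentialPart_nonneg q K W) one_pos (by simpa [nehari] using hn)
  exact ⟨t, h0, h1, by rw [nehari_smul _ _ _ _ h0.le, h]⟩

/-- Scaling down to the Nehari set by some `t ≤ 1` does not increase `reducedAction`, so competitors
need only satisfy an inequality, which is easier to verify for approximations. -/
lemma IsNehariMinimizer.le_of_nehari_nonpos {σ p q : ℝ} (hσ : 0 < σ ^ 2) (hp : 2 < p)
    (hq : 1 < q) (hqp : q < p) {K : ℝ≥0∞} {W U : ℝ → ℝ} (hW : IsNehariMinimizer σ p q K W)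
    (hU : U ∈ ansatz p q K) (hm : 0 < mass K U) (hn : nehari σ p q K U ≤ 0) :
    reducedAction σ p q K W ≤ reducedAction σ p q K U := by
  obtain ⟨t, h0, h1, h⟩ := exists_smul_nehari_eq_zero hσ hp hq hm hn
  refine (hW.le _ (smul_mem_ansatz hU t) ?_ h).trans
    (reducedAction_smul_le hp hq hqp K U h0.le h1)
  rw [mass_smul]; positivity

/-- A point with nonpositive Nehari functional and least reduced action lies on the Nehari
manifold. -/
lemma isNehariMinimizer_of_nehari_nonpos {σ p q : ℝ} (hσ : 0 < σ ^ 2) (hp : 2 < p)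
    (hq : 1 < q) (hqp : q < p) {K : ℝ≥0∞} {W : ℝ → ℝ} (hW : W ∈ ansatz p q K)
    (hm : 0 < mass K W) (hn : nehari σ p q K W ≤ 0)
    (hle : ∀ U ∈ ansatz p q K, 0 < mass K U → nehari σ p q K U = 0 →
      reducedAction σ p q K W ≤ reducedAction σ p q K U) :
    IsNehariMinimizer σ p q K W := by
  refine ⟨hW, hm, ?_, hle⟩
  obtain ⟨t, h0, h1, h⟩ := exists_smul_nehari_eq_zero hσ hp hq hm hn
  rcases h1.eq_or_lt with rfl | h1
  · simpa using h
  -- If `t < 1`, the rescaled function lies on the Nehari set with strictly smaller mass term,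
  -- contradicting `hle`.
  exfalso
  have hE := hle _ (smul_mem_ansatz hW t) (by rw [mass_smul]; positivity) h
  have c1 : 0 < 1 / 2 - 1 / p := by
    rw [sub_pos, div_lt_div_iff₀ (by linarith) (by norm_num)]; linarith
  have c2 : 0 ≤ 1 - q / p := by
    rw [sub_nonneg, div_le_one (by linarith)]; linarith
  unfold reducedAction at hE
  rw [mass_smul, potentialPart_smul _ _ h0.le] at hE
  have h5 : t ^ 2 * mass K W < mass K W :=
    mul_lt_of_lt_one_left hm (pow_lt_one₀ h0.le h1 two_ne_zero)
  have h6 : t ^ q * potentialPart q K W ≤ potentialPart q K W :=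
    mul_le_of_le_one_left (potentialPart_nonneg q K W) (Real.rpow_le_one h0.le h1.le (by linarith))
  have h7 := mul_lt_mul_of_pos_left h5 (mul_pos hσ c1)
  have h8 := mul_le_mul_of_nonneg_left h6 c2
  linarith

lemma IsNehariMinimizer.shift {σ p q : ℝ} (hp : 2 < p) (hq : 1 < q) {K : ℝ≥0∞} (hK : 0 < K)
    {W : ℝ → ℝ} (hW : IsNehariMinimizer σ p q K W) (s : ℝ) :
    IsNehariMinimizer σ p q K fun x => W (x + s) := by
  have hP : CellPeriodic K W := hW.mem.1
  refine ⟨shift_mem_ansatz hp hq hK hW.mem s, ?_, ?_, ?_⟩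
  · rw [mass_shift hP]; exact hW.mass_pos
  · rw [nehari, mass_shift hP, potentialPart_shift hP, potentialPart_shift hP]
    exact hW.nehari_eq
  · intro U hU hm hn
    rw [reducedAction, mass_shift hP, potentialPart_shift hP]
    exact hW.le U hU hm hn

/-- Functions with nonpositive Nehari functional have an average that is somewhere large. -/
lemma exists_le_abs_avg {σ p q : ℝ} (hp : 2 < p) (hq : 1 < q) {K : ℝ≥0∞}
    (hK : 0 < K) {W : ℝ → ℝ} (hW : CellL2 K W) (hm : 0 < mass K W)
    (hn : nehari σ p q K W ≤ 0) {η : ℝ} (hηp : p * η ^ (p - 2) < σ ^ 2) :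
    ∃ φ, η ≤ |avg W φ| := by
  -- If all averages were below `η`, then `p` times the `p`-part would be at most `p η^(p-2) mass <
  -- σ² mass`, making `nehari` positive.
  by_contra! h
  have h1 := hW.potentialPart_le hK hp.le fun φ => (h φ).le
  have h2 := potentialPart_nonneg q K W
  unfold nehari at hn
  have h3 : p * potentialPart p K W ≤ p * (η ^ (p - 2) * mass K W) :=
    mul_le_mul_of_nonneg_left h1 (by linarith)
  have h4 : 0 ≤ q * potentialPart q K W := by positivity
  have h5 := mul_lt_mul_of_pos_right hηp hm
  linarith

lemma exists_pos_mul_rpow_lt {S p : ℝ} (hS : 0 < S) (hp : 2 < p) :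
    ∃ η, 0 < η ∧ p * η ^ (p - 2) < S := by
  have h2 : Continuous fun t : ℝ => p * t ^ (p - 2) :=
    (Real.continuous_rpow_const (by linarith)).const_mul p
  have h3 := (h2.tendsto 0).mono_left (nhdsWithin_le_nhds (s := Ioi 0))
  rw [Real.zero_rpow (by linarith), mul_zero] at h3
  obtain ⟨η, h, h0⟩ := ((h3.eventually (gt_mem_nhds hS)).and self_mem_nhdsWithin).exists
  exact ⟨η, h0, h⟩

/-! ### Nehari minimizers are ground waves -/

/-- Suppose the derivative were negative. For small `s > 0` the perturbed ray crosses the Nehari set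
at some `t` close to `1`, where the action is below that of the unperturbed point scaled by `t`. By
`fibre_le` the latter is at most the action at `t = 1`, contradicting minimality. Only
differentiability of `a`, `b`, `c` at `0` enters, not smooth dependence of `t` on `s`. -/
lemma fibre_variation_nonneg {S p q : ℝ} (hS : 0 < S) (hp : 2 < p) (hq : 1 < q) (hqp : q < p)
    {a b c : ℝ → ℝ} {a' b' c' : ℝ} (ha : HasDerivAt a a' 0) (hb : HasDerivAt b b' 0)
    (hc : HasDerivAt c c' 0) (hb0 : 0 ≤ b 0) (ha0 : 0 < a 0)
    (h0 : S * a 0 + q * b 0 - p * c 0 = 0)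
    (hmin : ∀ s t, 0 < t → 0 < a s →
      S * (t ^ 2 * a s) + q * (t ^ q * b s) - p * (t ^ p * c s) = 0 →
      1 / 2 * S * a 0 + b 0 - c 0 ≤ 1 / 2 * S * (t ^ 2 * a s) + t ^ q * b s - t ^ p * c s) :
    0 ≤ 1 / 2 * S * a' + b' - c' := by
  by_contra! hneg
  -- Continuity jointly in `t` and the three difference quotients keeps the variation negative for
  -- every `t` within `δ` of `1`, whichever crossing is found.
  have hcont : ContinuousAt (fun z : ℝ × ℝ × ℝ × ℝ =>
      1 / 2 * S * (z.1 ^ 2 * z.2.1) + z.1 ^ q * z.2.2.1 - z.1 ^ p * z.2.2.2)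
      (1, a', b', c') := by
    have h1 : Continuous fun t : ℝ => t ^ q := Real.continuous_rpow_const (by linarith)
    have h2 : Continuous fun t : ℝ => t ^ p := Real.continuous_rpow_const (by linarith)
    fun_prop
  have hev := hcont.eventually_lt (g := fun _ => (0 : ℝ)) continuousAt_const (by simpa using hneg)
  rw [nhds_prod_eq, eventually_prod_iff] at hev
  obtain ⟨P, hP, Q, hQ, hPQ⟩ := hev
  obtain ⟨δ', hδ', hball⟩ := Metric.eventually_nhds_iff.1 hP
  obtain ⟨δ, hδ0, hδ1, hδδ'⟩ : ∃ δ : ℝ, 0 < δ ∧ δ < 1 ∧ δ < δ' :=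
    ⟨min (1 / 2) (δ' / 2), by positivity, (min_le_left _ _).trans_lt (by norm_num),
      (min_le_right _ _).trans_lt (by linarith)⟩
  have hslope : Tendsto (fun s => (slope a 0 s, slope b 0 s, slope c 0 s)) (𝓝[>] 0)
      (𝓝 (a', b', c')) := by
    have hle : 𝓝[>] (0 : ℝ) ≤ 𝓝[≠] 0 := nhdsWithin_mono _ fun x hx => (mem_Ioi.1 hx).ne'
    exact ((hasDerivAt_iff_tendsto_slope.1 ha).mono_left hle).prodMk_nhds
      (((hasDerivAt_iff_tendsto_slope.1 hb).mono_left hle).prodMk_nhds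
        ((hasDerivAt_iff_tendsto_slope.1 hc).mono_left hle))
  have hfib : ∀ t : ℝ, Tendsto
      (fun s => S * (t ^ 2 * a s) + q * (t ^ q * b s) - p * (t ^ p * c s)) (𝓝[>] 0)
      (𝓝 (S * (t ^ 2 * a 0) + q * (t ^ q * b 0) - p * (t ^ p * c 0))) := by
    intro t
    have h1 := ha.continuousAt
    have h2 := hb.continuousAt
    have h3 := hc.continuousAt
    have : ContinuousAt
        (fun s => S * (t ^ 2 * a s) + q * (t ^ q * b s) - p * (t ^ p * c s)) 0 := by fun_prop
    exact this.tendsto.mono_left nhdsWithin_le_nhds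
  -- The strict signs at `1 - δ` and `1 + δ` for `s = 0` persist for small `s` and trap a zero
  -- between them.
  have e1 := (hfib (1 - δ)).eventually (lt_mem_nhds
    (fibre_deriv_pos hS hp hq hqp ha0 hb0 h0 (by linarith) (by linarith)))
  have e2 := (hfib (1 + δ)).eventually (gt_mem_nhds
    (fibre_deriv_neg hS hp hq hqp ha0 hb0 h0 (by linarith)))
  have e3 : ∀ᶠ s in 𝓝[>] (0 : ℝ), 0 < a s :=
    (ha.continuousAt.tendsto.mono_left nhdsWithin_le_nhds).eventually (lt_mem_nhds ha0)
  obtain ⟨s, hs1, hs2, hs3, hs4, hs0⟩ := (e1.and (e2.and (e3.and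
    ((hslope.eventually hQ).and self_mem_nhdsWithin)))).exists
  obtain ⟨t, ht, hzero⟩ := intermediate_value_Icc' (by linarith : 1 - δ ≤ 1 + δ)
    (continuous_fibre_deriv (S := S) (a := a s) (b := b s) (c := c s) hp hq).continuousOn
    ⟨hs2.le, hs1.le⟩
  have ht0 : 0 < t := by linarith [ht.1]
  have hsm := hmin s t ht0 hs3 hzero
  have hle := fibre_le hS hp hq hqp ha0.le hb0 h0 ht0
  have hval := hPQ (hball (y := t) (by
    rw [Real.dist_eq]; exact (abs_le.2 ⟨by linarith [ht.1], by linarith [ht.2]⟩).trans_lt hδδ')) hs4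
  simp only [slope_def_field, sub_zero] at hval
  have hs0' : 0 < s := hs0
  have := mul_neg_of_pos_of_neg hs0' hval
  have e : s * (1 / 2 * S * (t ^ 2 * ((a s - a 0) / s)) + t ^ q * ((b s - b 0) / s)
      - t ^ p * ((c s - c 0) / s))
      = (1 / 2 * S * (t ^ 2 * a s) + t ^ q * b s - t ^ p * c s)
        - (1 / 2 * S * (t ^ 2 * a 0) + t ^ q * b 0 - t ^ p * c 0) := by
    field_simp; ring
  rw [e] at this
  linarith

/-- The hypotheses are invariant under `s ↦ -s`, which reverses the sign of the derivative. -/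
lemma fibre_variation_eq_zero {S p q : ℝ} (hS : 0 < S) (hp : 2 < p) (hq : 1 < q) (hqp : q < p)
    {a b c : ℝ → ℝ} {a' b' c' : ℝ} (ha : HasDerivAt a a' 0) (hb : HasDerivAt b b' 0)
    (hc : HasDerivAt c c' 0) (hb0 : 0 ≤ b 0) (ha0 : 0 < a 0)
    (h0 : S * a 0 + q * b 0 - p * c 0 = 0)
    (hmin : ∀ s t, 0 < t → 0 < a s →
      S * (t ^ 2 * a s) + q * (t ^ q * b s) - p * (t ^ p * c s) = 0 →
      1 / 2 * S * a 0 + b 0 - c 0 ≤ 1 / 2 * S * (t ^ 2 * a s) + t ^ q * b s - t ^ p * c s) :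
    1 / 2 * S * a' + b' - c' = 0 := by
  refine le_antisymm ?_ (fibre_variation_nonneg hS hp hq hqp ha hb hc hb0 ha0 h0 hmin)
  have hn : ∀ {f : ℝ → ℝ} {f' : ℝ}, HasDerivAt f f' 0 →
      HasDerivAt (fun s => f (-s)) (-f') 0 := by
    intro f f' hf
    have hf' : HasDerivAt f f' (-0) := by simpa using hf
    have h := hf'.comp 0 (hasDerivAt_neg (0 : ℝ))
    simpa [Function.comp_def] using h
  have := fibre_variation_nonneg hS hp hq hqp (hn ha) (hn hb) (hn hc) (by simpa using hb0)
    (by simpa using ha0) (by simpa using h0)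
    (fun s t ht has h => by simpa using hmin (-s) t ht has h)
  linarith

lemma IsNehariMinimizer.actionCritical {σ p q : ℝ} (hσ : 0 < σ ^ 2) (hp : 2 < p) (hq : 1 < q)
    (hqp : q < p) {K : ℝ≥0∞} (hK : 0 < K) {W : ℝ → ℝ} (hW : IsNehariMinimizer σ p q K W) :
    ActionCritical σ p q K W := by
  intro V hV
  have hW' := ((mem_ansatz_iff hp hq hK).1 hW.mem).1
  have hV' := ((mem_ansatz_iff hp hq hK).1 hV).1
  have h1 := hasDerivAt_mass hW' hV'
  have h2 := (hasDerivAt_potentialPart hq hK hW' hV' hW.mem.2.2.1 hV.2.2.1).2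
  have h3 := (hasDerivAt_potentialPart (by linarith : 1 < p) hK hW' hV' hW.mem.2.2.2 hV.2.2.2).2
  have key := fibre_variation_eq_zero hσ hp hq hqp h1 h2 h3 (potentialPart_nonneg _ _ _)
    (by simpa using hW.mass_pos) (by simpa [nehari] using hW.nehari_eq) ?_
  · have h4 := ((h1.const_mul (1 / 2 * σ ^ 2)).add h2).sub h3
    rw [key] at h4
    exact h4
  · intro s t ht has hz
    have hmem := smul_mem_ansatz (add_smul_mem_ansatz hp hq hK hW.mem hV s) t
    have hnz : nehari σ p q K (t • (W + s • V)) = 0 := by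
      rw [nehari_smul _ _ _ _ ht.le]; exact hz
    have hle := hW.le _ hmem (by rw [mass_smul]; positivity) hnz
    rw [← action_eq_reducedAction hp hnz, ← action_eq_reducedAction hp hW.nehari_eq] at hle
    have e2 : action σ p q K (t • (W + s • V)) = 1 / 2 * σ ^ 2 * (t ^ 2 * mass K (W + s • V))
        + t ^ q * potentialPart q K (W + s • V) - t ^ p * potentialPart p K (W + s • V) := by
      rw [← mass_smul, ← potentialPart_smul _ _ ht.le, ← potentialPart_smul _ _ ht.le]; rfl
    rw [e2] at hle
    simpa [action, mass] using hle

/-- Test with `V = W` and use `Ψ_r(w) w = r |w|^r`. This is why minimality on the Nehari set implies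
minimality among critical points. -/
lemma ActionCritical.nehari_eq {σ p q : ℝ} (hp : 2 < p) (hq : 1 < q) (hqp : q < p) {K : ℝ≥0∞}
    (hK : 0 < K) {W : ℝ → ℝ} (hc : ActionCritical σ p q K W) (hW : W ∈ ansatz p q K) :
    nehari σ p q K W = 0 := by
  have h := hc.weak_eq hp hq hK hW hW
  simp only [Psi_mul_self hq, Psi_mul_self (hq.trans hqp), integral_const_mul] at h
  simpa [nehari, mass, potentialPart, sq] using h

lemma nontrivialCriticalPoints_mass_pos {σ p q : ℝ} (hp : 2 < p) (hq : 1 < q) {K : ℝ≥0∞}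
    (hK : 0 < K) {W : ℝ → ℝ} (hW : W ∈ nontrivialCriticalPoints σ p q K) : 0 < mass K W := by
  refine lt_of_le_of_ne (mass_nonneg K W) fun h => hW.2.1 ?_
  exact (((mem_ansatz_iff hp hq hK).1 hW.1).1.ae_eq_zero_iff hK).2 h.symm

/-! ### The traveling wave equation -/

/-- The force term `Ψ_p(A W) - Ψ_q(A W)`. -/
def force (p q : ℝ) (W : ℝ → ℝ) (φ : ℝ) : ℝ := Psi p (avg W φ) - Psi q (avg W φ)

lemma CellL2.continuous_force {p q : ℝ} (hq : 1 < q) (hqp : q < p) {K : ℝ≥0∞} (hK : 0 < K)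
    {W : ℝ → ℝ} (hW : CellL2 K W) : Continuous (force p q W) :=
  ((continuous_Psi (hq.trans hqp)).comp (hW.continuous_avg hK)).sub
    ((continuous_Psi hq).comp (hW.continuous_avg hK))

lemma abs_force_le {p q : ℝ} (hq : 1 < q) (hqp : q < p) {W : ℝ → ℝ} {S φ : ℝ}
    (hS : |avg W φ| ≤ S) : |force p q W φ| ≤ p * S ^ (p - 1) + q * S ^ (q - 1) := by
  refine (abs_sub _ _).trans ?_
  rw [abs_Psi (hq.trans hqp), abs_Psi hq]
  have h1 := Real.rpow_le_rpow (abs_nonneg _) hS (by linarith : 0 ≤ p - 1)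
  have h2 := Real.rpow_le_rpow (abs_nonneg _) hS (by linarith : 0 ≤ q - 1)
  have hp0 : 0 ≤ p := by linarith
  gcongr

lemma CellL2.avg_force {p q : ℝ} (hq : 1 < q) (hqp : q < p) {K : ℝ≥0∞} (hK : 0 < K)
    {W : ℝ → ℝ} (hW : CellL2 K W) (φ : ℝ) :
    avg (force p q W) φ = avg (fun s => Psi p (avg W s)) φ - avg (fun s => Psi q (avg W s)) φ := by
  have h1 := (continuous_Psi (hq.trans hqp)).comp (hW.continuous_avg hK)
  have h2 := (continuous_Psi hq).comp (hW.continuous_avg hK)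
  exact intervalIntegral.integral_sub (h1.intervalIntegrable _ _) (h2.intervalIntegrable _ _)

/-- Critical points satisfy the traveling wave equation when tested with `V`. -/
lemma ActionCritical.integral_residual_mul {σ p q : ℝ} (hp : 2 < p) (hq : 1 < q) (hqp : q < p)
    {K : ℝ≥0∞} (hK : 0 < K) {W V : ℝ → ℝ} (hc : ActionCritical σ p q K W)
    (hW : W ∈ ansatz p q K) (hV : V ∈ ansatz p q K) (hVi : Integrable V (cellMeasure K)) :
    ∫ φ, (σ ^ 2 * W φ - avg (force p q W) φ) * V φ ∂(cellMeasure K) = 0 := by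
  have hW' := ((mem_ansatz_iff hp hq hK).1 hW).1
  have hV' := ((mem_ansatz_iff hp hq hK).1 hV).1
  obtain ⟨C, -, hC⟩ := hW'.exists_abs_avg_le hK
  have hGc := hW'.continuous_force hq hqp hK
  have hGb : ∀ φ, |force p q W φ| ≤ p * C ^ (p - 1) + q * C ^ (q - 1) :=
    fun φ => abs_force_le hq hqp (hC φ)
  -- Symmetry moves `avg` from the test function to the force; integrability of `V` is needed here
  -- because the force is only known to be bounded.
  have hsym := integral_mul_avg hK hGc hGb
    (hW'.periodic.avg.map fun w => Psi p w - Psi q w) hV'.periodic hVi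
  have h := hc.weak_eq hp hq hK hW hV
  have h2 := (hasDerivAt_potentialPart hq hK hW' hV' hW.2.2.1 hV.2.2.1).1
  have h3 := (hasDerivAt_potentialPart (by linarith : 1 < p) hK hW' hV' hW.2.2.2 hV.2.2.2).1
  have e1 : ∫ φ, force p q W φ * avg V φ ∂(cellMeasure K)
      = ∫ φ, Psi p (avg W φ) * avg V φ ∂(cellMeasure K)
        - ∫ φ, Psi q (avg W φ) * avg V φ ∂(cellMeasure K) := by
    rw [← integral_sub h3 h2]
    congr 1; ext φ; simp only [force]; ring
  have hWV : Integrable (fun φ => W φ * V φ) (cellMeasure K) := hW'.memLp.integrable_mul hV'.memLp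
  have hAG : Integrable (fun φ => avg (force p q W) φ * V φ) (cellMeasure K) := by
    refine hVi.bdd_mul (c := p * C ^ (p - 1) + q * C ^ (q - 1))
      (continuous_avg fun x y => hGc.intervalIntegrable x y).aestronglyMeasurable
      (Eventually.of_forall fun φ => abs_avg_le_of_abs_le hGb φ)
  have e2 : ∫ φ, (σ ^ 2 * W φ - avg (force p q W) φ) * V φ ∂(cellMeasure K)
      = σ ^ 2 * ∫ φ, W φ * V φ ∂(cellMeasure K)
        - ∫ φ, avg (force p q W) φ * V φ ∂(cellMeasure K) := by
    rw [← integral_const_mul, ← integral_sub (hWV.const_mul _) hAG]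
    congr 1; ext φ; ring
  rw [e2, ← hsym, e1]; linarith

/-- Bounded functions supported in a bounded interval belong to the ansatz space of the line. -/
lemma mem_ansatz_top_of_bounded {p q : ℝ} (hp : 2 < p) (hq : 1 < q) {V : ℝ → ℝ}
    (hV : AEStronglyMeasurable V volume) {C R : ℝ} (hC : ∀ x, |V x| ≤ C)
    (hR : ∀ x, R < |x| → V x = 0) :
    V ∈ ansatz p q ∞ ∧ Integrable V volume := by
  have hVR : V = (Icc (-R) R).indicator V := by
    ext x
    by_cases hx : x ∈ Icc (-R) R
    · rw [indicator_of_mem hx]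
    · rw [indicator_of_notMem hx]
      exact hR x (by by_contra! h; exact hx (abs_le.1 h))
  have hint : ∀ f : ℝ → ℝ, AEStronglyMeasurable f volume → ∀ D, (∀ x, |f x| ≤ D) →
      ∀ R, (∀ x, R < |x| → f x = 0) → Integrable f volume := by
    intro f hf D hD R hR
    have : Integrable ((Icc (-R) R).indicator fun _ => D) volume :=
      (integrable_indicator_iff measurableSet_Icc).2 (by simp)
    refine this.mono' hf (Eventually.of_forall fun x => ?_)
    by_cases hx : x ∈ Icc (-R) R
    · rw [indicator_of_mem hx]; exact hD x
    · rw [indicator_of_notMem hx, hR x (by by_contra! h; exact hx (abs_le.1 h))]; simp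
  have hVi := hint V hV C hC R hR
  have hC0 : 0 ≤ C := (abs_nonneg _).trans (hC 0)
  have hL2 : CellL2 ∞ V := by
    refine ⟨fun h => absurd rfl h, ?_⟩
    rw [cellMeasure_top, memLp_two_iff_integrable_sq hV]
    refine hint _ (hV.pow 2) (C ^ 2) (fun x => ?_) R fun x hx => by simp [hR x hx]
    rw [abs_pow]; exact pow_le_pow_left₀ (abs_nonneg _) (hC x) 2
  obtain ⟨D, -, hD⟩ := hL2.exists_abs_avg_le ENNReal.zero_lt_top
  refine ⟨(mem_ansatz_iff hp hq ENNReal.zero_lt_top).2 ⟨hL2, ?_⟩, hVi⟩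
  rw [cellMeasure_top]
  -- Averaging enlarges the support by the half-width `1 / 2` of the window.
  refine hint _ (hL2.continuous_abs_avg_rpow ENNReal.zero_lt_top (by linarith)).aestronglyMeasurable
    (D ^ q) (fun x => ?_) (R + 1 / 2) fun x hx => ?_
  · rw [abs_of_nonneg (by positivity)]
    exact Real.rpow_le_rpow (abs_nonneg _) (hD x) (by linarith)
  · have : avg V x = 0 := by
      rw [avg, intervalIntegral.integral_congr (g := fun _ => 0), intervalIntegral.integral_zero]
      intro s hs
      rw [uIcc_of_le (by linarith)] at hs
      refine hR s ?_
      rcases lt_abs.1 hx with h | h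
      · exact lt_abs.2 (Or.inl (by linarith [hs.1]))
      · exact lt_abs.2 (Or.inr (by linarith [hs.2]))
    rw [this, abs_zero, Real.zero_rpow (by linarith)]

/-- The residual `R` is tested with `Θ (R)`, where `Θ` is bounded and `x * Θ x` is nonnegative and
vanishes only at `0`. Boundedness makes `Θ (R)` admissible on a bounded cell and, cut off to `[-n,
n]`, on the line. -/
lemma ActionCritical.travelingWaveEq {σ p q : ℝ} (hp : 2 < p) (hq : 1 < q) (hqp : q < p)
    {K : ℝ≥0∞} (hK : 0 < K) {W : ℝ → ℝ} (hc : ActionCritical σ p q K W)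
    (hW : W ∈ ansatz p q K) : TravelingWaveEq σ p q W := by
  have hW' := ((mem_ansatz_iff hp hq hK).1 hW).1
  set R : ℝ → ℝ := fun φ => σ ^ 2 * W φ - avg (force p q W) φ with hRdef
  have hGc := hW'.continuous_force hq hqp hK
  have hRm : AEStronglyMeasurable R volume :=
    ((hW'.aestronglyMeasurable hK).const_mul _).sub
      (continuous_avg fun x y => hGc.intervalIntegrable x y).aestronglyMeasurable
  have hRp : CellPeriodic K R :=
    hW'.periodic.map₂ (CellPeriodic.avg (hW'.periodic.avg.map fun w => Psi p w - Psi q w))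
      fun w v => σ ^ 2 * w - v
  set Θ : ℝ → ℝ := fun x => x / (1 + |x|) with hΘ
  have hΘc : Continuous Θ :=
    continuous_id.div (continuous_const.add continuous_abs) fun x => by positivity
  have hΘb : ∀ x, |Θ x| ≤ 1 := by
    intro x
    rw [hΘ]; simp only
    rw [abs_div, abs_of_pos (by positivity : 0 < 1 + |x|), div_le_one (by positivity)]
    linarith
  have hΘ0 : ∀ x, 0 ≤ x * Θ x := by
    intro x
    have : x * Θ x = x ^ 2 / (1 + |x|) := by simp only [hΘ]; ring
    rw [this]; positivity
  have hΘz : ∀ x, x * Θ x = 0 → x = 0 := by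
    intro x hx
    have e : x * Θ x = x ^ 2 / (1 + |x|) := by simp only [hΘ]; ring
    rw [e, div_eq_zero_iff] at hx
    rcases hx with hx | hx
    · simpa using hx
    · have := abs_nonneg x; linarith
  have hR0 : R =ᵐ[volume] 0 := by
    by_cases hT : K = ∞
    · subst hT
      have hN : ∀ n : ℕ, ∀ᵐ x ∂(volume.restrict (Icc (-(n : ℝ)) n)), R x = 0 := by
        intro n
        set V : ℝ → ℝ := (Icc (-(n : ℝ)) n).indicator fun x => Θ (R x) with hV
        have hVb : ∀ x, |V x| ≤ 1 := by
          intro x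
          by_cases hx : x ∈ Icc (-(n : ℝ)) n
          · rw [hV, indicator_of_mem hx]; exact hΘb _
          · rw [hV, indicator_of_notMem hx]; simp
        obtain ⟨hVm, hVi⟩ := mem_ansatz_top_of_bounded (V := V) (C := 1) (R := n) hp hq
          ((hΘc.comp_aestronglyMeasurable hRm).indicator measurableSet_Icc) hVb
          fun x hx => indicator_of_notMem (s := Icc (-(n : ℝ)) n)
            (fun h => absurd hx (not_lt.2 (abs_le.2 ⟨h.1, h.2⟩))) _
        have h0 := hc.integral_residual_mul hp hq hqp hK hW hVm (by rwa [cellMeasure_top])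
        rw [cellMeasure_top] at h0
        have e : (fun φ => (σ ^ 2 * W φ - avg (force p q W) φ) * V φ)
            = (Icc (-(n : ℝ)) n).indicator fun x => R x * Θ (R x) := by
          ext x
          by_cases hx : x ∈ Icc (-(n : ℝ)) n
          · rw [hV, indicator_of_mem hx, indicator_of_mem hx]
          · rw [hV, indicator_of_notMem hx, indicator_of_notMem hx, mul_zero]
        rw [e, integral_indicator measurableSet_Icc, integral_eq_zero_iff_of_nonneg
          (fun x => hΘ0 _)] at h0
        · filter_upwards [h0] with x hx using hΘz _ hx
        · have hRi : IntegrableOn R (Icc (-(n : ℝ)) n) := by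
            have h1 : IntegrableOn W (Icc (-(n : ℝ)) n) :=
              (intervalIntegrable_iff_integrableOn_Icc_of_le (by
                have : (0:ℝ) ≤ n := n.cast_nonneg
                linarith)).1 (hW'.intervalIntegrable hK _ _)
            exact (h1.const_mul _).sub
              ((continuous_avg fun x y => hGc.intervalIntegrable x y).integrableOn_Icc)
          exact hRi.mul_bdd (c := 1) (hΘc.comp_aestronglyMeasurable hRm).restrict
            (Eventually.of_forall fun x => hΘb _)
      have hU : (⋃ n : ℕ, Icc (-(n : ℝ)) n) = univ := by
        refine eq_univ_of_forall fun x => mem_iUnion.2 ?_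
        obtain ⟨n, hn⟩ := exists_nat_gt |x|
        exact ⟨n, (abs_lt.1 hn).1.le, (abs_lt.1 hn).2.le⟩
      have := (ae_restrict_iUnion_iff (μ := volume) (fun n : ℕ => Icc (-(n : ℝ)) n)
        (fun x => R x = 0)).2 hN
      rwa [hU, Measure.restrict_univ] at this
    · have := isFiniteMeasure_cellMeasure hT
      refine hRp.ae_eq_zero_of_cell hK ?_
      have hVm : AEStronglyMeasurable (fun x => Θ (R x)) (cellMeasure K) :=
        (hΘc.comp_aestronglyMeasurable hRm).mono_measure (cellMeasure_le_volume K)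
      have hV2 : CellL2 K fun x => Θ (R x) :=
        ⟨hRp.map Θ, MemLp.of_bound hVm 1 (Eventually.of_forall fun x => hΘb _)⟩
      have h0 := hc.integral_residual_mul hp hq hqp hK hW
        (mem_ansatz_of_ne_top hp hq hK hT hV2) (hV2.memLp.integrable (by norm_num))
      rw [integral_eq_zero_iff_of_nonneg (fun x => hΘ0 (R x))] at h0
      · filter_upwards [h0] with x hx using hΘz _ hx
      · have hRi : Integrable R (cellMeasure K) := by
          rw [integrable_cellMeasure_iff_of_ne_top hT]
          exact ((hW'.intervalIntegrable hK _ _).const_mul _).sub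
            ((continuous_avg fun x y => hGc.intervalIntegrable x y).intervalIntegrable _ _)
        exact hRi.mul_bdd (c := 1) hVm (Eventually.of_forall fun x => hΘb _)
  filter_upwards [hR0] with φ hφ
  have : σ ^ 2 * W φ - avg (force p q W) φ = 0 := hφ
  rw [hW'.avg_force hq hqp hK] at this
  linarith

lemma IsNehariMinimizer.isGroundWave {σ p q : ℝ} (hσ : 0 < σ ^ 2) (hp : 2 < p) (hq : 1 < q)
    (hqp : q < p) {K : ℝ≥0∞} (hK : 0 < K) {W : ℝ → ℝ} (hW : IsNehariMinimizer σ p q K W) :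
    IsGroundWave σ p q K W := by
  have hc := hW.actionCritical hσ hp hq hqp hK
  have hW' := ((mem_ansatz_iff hp hq hK).1 hW.mem).1
  have hmem : W ∈ nontrivialCriticalPoints σ p q K :=
    ⟨hW.mem, fun h => hW.mass_pos.ne' ((hW'.ae_eq_zero_iff hK).1 h), hc⟩
  refine ⟨hmem, hc.travelingWaveEq hp hq hqp hK hW.mem, mem_image_of_mem _ hmem, ?_⟩
  rintro _ ⟨U, hU, rfl⟩
  have hn := hU.2.2.nehari_eq hp hq hqp hK hU.1
  rw [action_eq_reducedAction hp hW.nehari_eq, action_eq_reducedAction hp hn]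
  exact hW.le U hU.1 (nontrivialCriticalPoints_mass_pos hp hq hK hU) hn

lemma IsNehariMinimizer.action_pos {σ p q : ℝ} (hσ : 0 < σ ^ 2) (hp : 2 < p) (hqp : q < p)
    {K : ℝ≥0∞} {W : ℝ → ℝ} (hW : IsNehariMinimizer σ p q K W) : 0 < action σ p q K W := by
  rw [action_eq_reducedAction hp hW.nehari_eq]
  exact reducedAction_pos hσ hp hqp hW.mass_pos

/-! ### Weak compactness -/

/-- Bounded sequences in `L²(ℝ)` have weakly convergent subsequences. -/
lemma exists_weak_limit {f : ℕ → ℝ → ℝ} (hf : ∀ n, MemLp (f n) 2 volume) {M : ℝ}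
    (hM : ∀ n, ∫ x, f n x ^ 2 ≤ M) :
    ∃ τ : ℕ → ℕ, StrictMono τ ∧ ∃ V : ℝ → ℝ, MemLp V 2 volume ∧
      ∀ g : ℝ → ℝ, MemLp g 2 volume →
        Tendsto (fun n => ∫ x, f (τ n) x * g x) atTop (𝓝 (∫ x, V x * g x)) := by
  let F : ℕ → Lp ℝ 2 (volume : Measure ℝ) := fun n => (hf n).toLp
  have hinner : ∀ (u v : Lp ℝ 2 (volume : Measure ℝ)), inner ℝ u v = ∫ x, u x * v x := by
    intro u v
    rw [L2.inner_def]
    congr 1; ext x; simp [mul_comm]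
  have hnorm : ∀ n, ‖F n‖ ≤ √M := by
    intro n
    refine Real.le_sqrt_of_sq_le ?_
    rw [← real_inner_self_eq_norm_sq, hinner]
    refine le_trans (le_of_eq ?_) (hM n)
    refine integral_congr_ae ?_
    filter_upwards [(hf n).coeFn_toLp] with x hx
    simp only [F, hx, sq]
  let D : ℕ → WeakDual ℝ (Lp ℝ 2 (volume : Measure ℝ)) := fun n =>
    StrongDual.toWeakDual (InnerProductSpace.toDual ℝ _ (F n))
  have hball : ∀ n, D n ∈ WeakDual.toStrongDual ⁻¹' Metric.closedBall
      (0 : StrongDual ℝ (Lp ℝ 2 (volume : Measure ℝ))) (√M) := by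
    intro n
    rw [mem_preimage, mem_closedBall_zero_iff]
    change ‖InnerProductSpace.toDual ℝ _ (F n)‖ ≤ _
    rw [LinearIsometryEquiv.norm_map]
    exact hnorm n
  -- Supplies the instance for separability of `L²(ℝ)`, which turns Banach-Alaoglu into sequential
  -- compactness.
  have : Fact ((2 : ℝ≥0∞) ≠ ∞) := ⟨by norm_num⟩
  have : SecondCountableTopology (Lp ℝ 2 (volume : Measure ℝ)) := inferInstance
  obtain ⟨d, -, τ, hτ, hlim⟩ := WeakDual.isSeqCompact_closedBall ℝ
    (Lp ℝ 2 (volume : Measure ℝ)) 0 (√M) hball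
  let v := (InnerProductSpace.toDual ℝ (Lp ℝ 2 (volume : Measure ℝ))).symm
    (WeakDual.toStrongDual d)
  refine ⟨τ, hτ, v, Lp.memLp v, fun g hg => ?_⟩
  have h2 : Tendsto (fun n => D (τ n) hg.toLp) atTop (𝓝 (d hg.toLp)) :=
    ((WeakDual.eval_continuous (hg.toLp)).tendsto d).comp hlim
  have e1 : ∀ n, D (τ n) hg.toLp = ∫ x, f (τ n) x * g x := by
    intro n
    change inner ℝ (F (τ n)) hg.toLp = _
    rw [hinner]
    refine integral_congr_ae ?_
    filter_upwards [(hf (τ n)).coeFn_toLp, hg.coeFn_toLp] with x hx hx'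
    simp only [F, hx, hx']
  have e2 : d hg.toLp = ∫ x, v x * g x := by
    have : d hg.toLp = inner ℝ v hg.toLp := by
      simp only [v, InnerProductSpace.toDual_symm_apply]; rfl
    rw [this, hinner]
    refine integral_congr_ae ?_
    filter_upwards [hg.coeFn_toLp] with x hx
    simp only [hx]
  simpa only [e1, e2] using h2

lemma CellL2.memLp_indicator {K : ℝ≥0∞} {W : ℝ → ℝ} (hW : CellL2 K W) :
    MemLp ((cell K).indicator W) 2 volume :=
  (memLp_indicator_iff_restrict (measurableSet_cell K)).2 hW.memLp

lemma integral_indicator_sq (K : ℝ≥0∞) (W : ℝ → ℝ) :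
    ∫ x, (cell K).indicator W x ^ 2 = mass K W := by
  rw [mass, cellMeasure, ← integral_indicator (measurableSet_cell K)]
  congr 1; ext x
  by_cases hx : x ∈ cell K <;> simp [hx]

lemma memLp_indicator_Ioc_one (x y : ℝ) :
    MemLp ((Ioc x y).indicator fun _ => (1 : ℝ)) 2 volume :=
  memLp_indicator_const 2 measurableSet_Ioc 1 (Or.inr (by simp))

lemma intervalIntegral_eq_integral_indicator {K : ℝ≥0∞} (W : ℝ → ℝ) {x y : ℝ} (hxy : x ≤ y)
    (hsub : Ioc x y ⊆ cell K) :
    ∫ s in x..y, W s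
      = ∫ s, (cell K).indicator W s * (Ioc x y).indicator (fun _ => (1 : ℝ)) s := by
  rw [intervalIntegral.integral_of_le hxy, ← integral_indicator measurableSet_Ioc]
  congr 1; ext s
  by_cases hs : s ∈ Ioc x y
  · simp [hs, hsub hs]
  · simp [hs]

/-- Extension by zero places functions on varying cells in the common space `L²(ℝ)`. The sequence
`b` will be the `q`-part, made convergent along the same subsequence. -/
lemma exists_subseq_weak_limit {K : ℕ → ℝ≥0∞} {W : ℕ → ℝ → ℝ}
    (hW : ∀ n, CellL2 (K n) (W n)) {M : ℝ} (ha : ∀ n, mass (K n) (W n) ≤ M) {b : ℕ → ℝ}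
    (hb0 : ∀ n, 0 ≤ b n) (hb : ∀ n, b n ≤ M) :
    ∃ τ : ℕ → ℕ, StrictMono τ ∧ ∃ (V : ℝ → ℝ) (a' b' : ℝ), MemLp V 2 volume ∧
      (∀ g : ℝ → ℝ, MemLp g 2 volume →
        Tendsto (fun n => ∫ x, (cell (K (τ n))).indicator (W (τ n)) x * g x) atTop
          (𝓝 (∫ x, V x * g x))) ∧
      Tendsto (fun n => mass (K (τ n)) (W (τ n))) atTop (𝓝 a') ∧
      Tendsto (fun n => b (τ n)) atTop (𝓝 b') ∧ ∫ x, V x ^ 2 ≤ a' := by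
  obtain ⟨τ₁, hτ₁, V, hV, hweak⟩ := exists_weak_limit (fun n => (hW n).memLp_indicator)
    (M := M) (fun n => by rw [integral_indicator_sq]; exact ha n)
  obtain ⟨⟨a', b'⟩, -, τ₂, hτ₂, hlim⟩ := (isCompact_Icc (a := ((0 : ℝ), (0 : ℝ)))
    (b := (M, M))).tendsto_subseq (x := fun n => (mass (K (τ₁ n)) (W (τ₁ n)), b (τ₁ n)))
    (fun n => ⟨⟨mass_nonneg _ _, hb0 _⟩, ⟨ha _, hb _⟩⟩)
  have ha' : Tendsto (fun n => mass (K (τ₁ (τ₂ n))) (W (τ₁ (τ₂ n)))) atTop (𝓝 a') :=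
    (continuous_fst.tendsto _).comp hlim
  have hb' : Tendsto (fun n => b (τ₁ (τ₂ n))) atTop (𝓝 b') := (continuous_snd.tendsto _).comp hlim
  have hweak' := fun g hg => (hweak g hg).comp hτ₂.tendsto_atTop
  refine ⟨τ₁ ∘ τ₂, hτ₁.comp hτ₂, V, a', b', hV, hweak', ha', hb', ?_⟩
  -- Weak lower semicontinuity of the mass: pass to the limit in `2 f V ≤ f² + V²`.
  have h1 := (hweak' V hV).const_mul 2
  have h2 : ∀ n, 2 * ∫ x, (cell (K (τ₁ (τ₂ n)))).indicator (W (τ₁ (τ₂ n))) x * V x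
      ≤ mass (K (τ₁ (τ₂ n))) (W (τ₁ (τ₂ n))) + ∫ x, V x ^ 2 := by
    intro n
    have hm := (hW (τ₁ (τ₂ n))).memLp_indicator
    rw [← integral_indicator_sq, ← integral_const_mul,
      ← integral_add hm.integrable_sq hV.integrable_sq]
    refine integral_mono ((hm.integrable_mul hV).const_mul 2)
      (hm.integrable_sq.add hV.integrable_sq) fun x => ?_
    have := two_mul_le_add_sq ((cell (K (τ₁ (τ₂ n)))).indicator (W (τ₁ (τ₂ n))) x) (V x)
    linarith
  have h3 := le_of_tendsto_of_tendsto' h1 (ha'.add_const (∫ x, V x ^ 2)) h2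
  have e : ∫ x, V x * V x = ∫ x, V x ^ 2 := by simp only [sq]
  rw [e] at h3; linarith

/-! ### Periodization -/

/-- The `2K`-periodic function that agrees with `U` on the cell. -/
def periodize (K : ℝ≥0∞) (U : ℝ → ℝ) (x : ℝ) : ℝ :=
  U (x - 2 * K.toReal * ⌈(x - K.toReal) / (2 * K.toReal)⌉)

lemma periodize_periodic {K : ℝ≥0∞} (hK : 0 < K) (U : ℝ → ℝ) : CellPeriodic K (periodize K U) := by
  intro hT x
  have hpos : 0 < K.toReal := ENNReal.toReal_pos hK.ne' hT
  have e : (x + 2 * K.toReal - K.toReal) / (2 * K.toReal)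
      = (x - K.toReal) / (2 * K.toReal) + 1 := by field_simp; ring
  simp only [periodize, e, Int.ceil_add_one]
  push_cast
  congr 1; ring

lemma periodize_eq {K : ℝ≥0∞} (hT : K ≠ ∞) (U : ℝ → ℝ) {x : ℝ} (hx : x ∈ cell K) :
    periodize K U x = U x := by
  rw [cell_of_ne_top hT] at hx
  have hpos : 0 < K.toReal := by linarith [hx.1, hx.2]
  -- The ceiling matches the half-open cell `(-K, K]`, including its right endpoint.
  have e : ⌈(x - K.toReal) / (2 * K.toReal)⌉ = 0 := by
    rw [Int.ceil_eq_iff]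
    constructor
    · rw [lt_div_iff₀ (by positivity)]; push_cast; linarith [hx.1]
    · rw [div_le_iff₀ (by positivity)]; push_cast; linarith [hx.2]
  simp [periodize, e]

lemma periodize_ae_eq {K : ℝ≥0∞} (hT : K ≠ ∞) (U : ℝ → ℝ) :
    periodize K U =ᵐ[cellMeasure K] U :=
  (ae_restrict_iff' (measurableSet_cell K)).2 (Eventually.of_forall fun _ hx => periodize_eq hT U hx)

lemma periodize_cellL2 {K : ℝ≥0∞} (hK : 0 < K) (hT : K ≠ ∞) {U : ℝ → ℝ} (hU : MemLp U 2 volume) :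
    CellL2 K (periodize K U) :=
  ⟨periodize_periodic hK U,
    (memLp_congr_ae (periodize_ae_eq hT U)).2 (hU.mono_measure (cellMeasure_le_volume K))⟩

lemma mass_periodize_le {K : ℝ≥0∞} (hT : K ≠ ∞) {U : ℝ → ℝ} (hU : MemLp U 2 volume) :
    mass K (periodize K U) ≤ ∫ x, U x ^ 2 := by
  have e : mass K (periodize K U) = ∫ x, U x ^ 2 ∂(cellMeasure K) :=
    integral_congr_ae (by filter_upwards [periodize_ae_eq hT U] with x hx; rw [hx])
  rw [e]
  exact setIntegral_le_integral hU.integrable_sq (Eventually.of_forall fun _ => sq_nonneg _)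

/-! ### Existence of minimizers on bounded cells -/

/-- Weak convergence on a bounded cell implies pointwise convergence of the averages. -/
lemma tendsto_avg_of_weak {K : ℝ≥0∞} (hK : 0 < K) (hT : K ≠ ∞) {W : ℕ → ℝ → ℝ} {U : ℝ → ℝ}
    (hW : ∀ n, CellL2 K (W n)) (hU : CellL2 K U)
    (hweak : ∀ x y, x ≤ y → Ioc x y ⊆ cell K →
      Tendsto (fun n => ∫ s in x..y, W n s) atTop (𝓝 (∫ s in x..y, U s))) (φ : ℝ) :
    Tendsto (fun n => avg (W n) φ) atTop (𝓝 (avg U φ)) := by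
  have hpos : 0 < K.toReal := ENNReal.toReal_pos hK.ne' hT
  set L := K.toReal with hL
  have hcell := cell_of_ne_top hT
  rw [← hL] at hcell
  -- The averaging window may leave the cell or span several periods, so primitives are reduced
  -- modulo the period to intervals inside the cell, where weak convergence applies.
  have hprim : ∀ x : ℝ, ∃ m : ℤ, ∃ y ∈ Icc (-L) L, y + m • (2 * L) = x := by
    intro x
    have hx := toIocMod_mem_Ioc (by linarith : 0 < 2 * L) (-L) x
    refine ⟨toIocDiv (by linarith : 0 < 2 * L) (-L) x, _, ⟨hx.1.le, by linarith [hx.2]⟩,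
      toIocMod_add_toIocDiv_zsmul _ _ _⟩
  have hsplit : ∀ {f : ℝ → ℝ}, CellL2 K f → ∀ (m : ℤ) (y : ℝ),
      ∫ s in (-L)..(y + m • (2 * L)), f s
        = (∫ s in (-L)..y, f s) + m • ∫ s in (-L)..L, f s := by
    intro f hf m y
    have hii := hf.intervalIntegrable hK
    have h1 := (hf.periodic hT).intervalIntegral_add_zsmul_eq m y hii
    rw [(hf.periodic hT).intervalIntegral_add_eq y (-K.toReal)] at h1
    rw [← intervalIntegral.integral_add_adjacent_intervals (hii (-L) y) (hii y _), h1, ← hL,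
      show -L + 2 * L = L by ring]
  have hconv : ∀ x, Tendsto (fun n => ∫ s in (-L)..x, W n s) atTop (𝓝 (∫ s in (-L)..x, U s)) := by
    intro x
    obtain ⟨m, y, hy, rfl⟩ := hprim x
    simp only [hsplit hU, fun n => hsplit (hW n)]
    refine (hweak _ _ hy.1 ?_).add ((hweak _ _ (by linarith) ?_).const_smul m)
    · rw [hcell]; exact Ioc_subset_Ioc_right hy.2
    · rw [hcell]
  have e : ∀ {f : ℝ → ℝ}, CellL2 K f →
      avg f φ = (∫ s in (-L)..(φ + 1 / 2), f s) - ∫ s in (-L)..(φ - 1 / 2), f s := by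
    intro f hf
    rw [intervalIntegral.integral_interval_sub_left (hf.intervalIntegrable hK _ _)
      (hf.intervalIntegrable hK _ _)]; rfl
  simp only [e hU, fun n => e (hW n)]
  exact (hconv _).sub (hconv _)

lemma exists_mem_nehari {σ p q : ℝ} (hσ : 0 < σ ^ 2) (hp : 2 < p) (hq : 1 < q) (hqp : q < p)
    {K : ℝ≥0∞} {W : ℝ → ℝ} (hW : W ∈ ansatz p q K) (hm : 0 < mass K W)
    (hc : 0 < potentialPart p K W) :
    ∃ U ∈ ansatz p q K, 0 < mass K U ∧ nehari σ p q K U = 0 := by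
  obtain ⟨t₀, h0, hneg⟩ := exists_fibre_deriv_neg (S := σ ^ 2) (a := mass K W)
    (b := potentialPart q K W) (q := q) hp hqp hc
  obtain ⟨t, ht, -, h⟩ := exists_fibre_deriv_eq_zero hσ hp hq hm (potentialPart_nonneg q K W) h0
    hneg.le
  exact ⟨t • W, smul_mem_ansatz hW t, by rw [mass_smul]; positivity,
    by rw [nehari_smul _ _ _ _ ht.le, h]⟩

lemma exists_mem_nehari_of_ne_top {σ p q : ℝ} (hσ : 0 < σ ^ 2) (hp : 2 < p) (hq : 1 < q)
    (hqp : q < p) {K : ℝ≥0∞} (hK : 0 < K) (hT : K ≠ ∞) :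
    ∃ U ∈ ansatz p q K, 0 < mass K U ∧ nehari σ p q K U = 0 := by
  have := isFiniteMeasure_cellMeasure hT
  have hpos : 0 < K.toReal := ENNReal.toReal_pos hK.ne' hT
  have h1 : CellL2 K fun _ => 1 := ⟨fun _ _ => rfl, memLp_const 1⟩
  have e : avg (fun _ => 1) = fun _ => 1 := by
    ext φ; simp [avg]; norm_num
  refine exists_mem_nehari hσ hp hq hqp (mem_ansatz_of_ne_top hp hq hK hT h1) ?_ ?_
  · rw [mass, integral_cellMeasure_of_ne_top hT]; simp; linarith
  · rw [potentialPart, integral_cellMeasure_of_ne_top hT]; simp [e]; linarith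

lemma mass_le_of_reducedAction_le {σ p q M : ℝ} (hσ : 0 < σ ^ 2) (hp : 2 < p) (hqp : q < p)
    {K : ℝ≥0∞} {W : ℝ → ℝ} (h : reducedAction σ p q K W ≤ M) :
    mass K W ≤ M / (σ ^ 2 * (1 / 2 - 1 / p)) ∧ potentialPart q K W ≤ M / (1 - q / p) := by
  have h1 : 0 < 1 / 2 - 1 / p := by
    rw [sub_pos, div_lt_div_iff₀ (by linarith) (by norm_num)]; linarith
  have h2 : 0 < 1 - q / p := by
    rw [sub_pos, div_lt_one (by linarith)]; linarith
  have h3 : 0 ≤ σ ^ 2 * (1 / 2 - 1 / p) * mass K W := mul_nonneg (by positivity) (mass_nonneg _ _)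
  have h4 : 0 ≤ (1 - q / p) * potentialPart q K W := mul_nonneg h2.le (potentialPart_nonneg _ _ _)
  unfold reducedAction at h
  constructor
  · rw [le_div_iff₀ (by positivity)]; linarith
  · rw [le_div_iff₀ h2]; linarith

lemma CellL2.mass_pos_of_avg_ne_zero {K : ℝ≥0∞} (hK : 0 < K) {W : ℝ → ℝ} (hW : CellL2 K W)
    {φ : ℝ} (h : avg W φ ≠ 0) : 0 < mass K W := by
  refine lt_of_le_of_ne (mass_nonneg K W) fun h0 => h ?_
  have := (hW.ae_eq_zero_iff hK).2 h0.symm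
  rw [avg, intervalIntegral.integral_congr_ae (g := fun _ => 0)
    (by filter_upwards [this] with x hx _ using hx), intervalIntegral.integral_zero]

theorem exists_isNehariMinimizer_of_ne_top {σ p q : ℝ} (hσ : 0 < σ ^ 2) (hp : 2 < p) (hq : 1 < q)
    (hqp : q < p) {K : ℝ≥0∞} (hK : 0 < K) (hT : K ≠ ∞) :
    ∃ W, IsNehariMinimizer σ p q K W := by
  have := isFiniteMeasure_cellMeasure hT
  obtain ⟨η, hη, hηp⟩ := exists_pos_mul_rpow_lt hσ hp
  set N : Set (ℝ → ℝ) := {U | U ∈ ansatz p q K ∧ 0 < mass K U ∧ nehari σ p q K U = 0} with hN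
  set E : Set ℝ := reducedAction σ p q K '' N with hE
  have hne : E.Nonempty := by
    obtain ⟨U, h1, h2, h3⟩ := exists_mem_nehari_of_ne_top hσ hp hq hqp hK hT
    exact ⟨_, U, ⟨h1, h2, h3⟩, rfl⟩
  have hbdd : BddBelow E := ⟨0, by rintro _ ⟨U, -, rfl⟩; exact reducedAction_nonneg hp hqp K U⟩
  obtain ⟨u, -, hu, huE⟩ := exists_seq_tendsto_sInf hne hbdd
  choose Z hZ hZu using huE
  have hshift : ∀ n, ∃ s, η ≤ |avg (Z n) s| := fun n =>
    exists_le_abs_avg hp hq hK ((mem_ansatz_iff hp hq hK).1 (hZ n).1).1 (hZ n).2.1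
      (hZ n).2.2.le hηp
  choose s hs using hshift
  -- Translation puts a point with `|avg| ≥ η` at the origin and changes neither `nehari` nor
  -- `reducedAction`.
  set W : ℕ → ℝ → ℝ := fun n x => Z n (x + s n) with hWdef
  have hper : ∀ n, CellPeriodic K (Z n) := fun n => (hZ n).1.1
  have hW : ∀ n, CellL2 K (W n) := fun n =>
    ((mem_ansatz_iff hp hq hK).1 (hZ n).1).1.shift hK (s n)
  have hWn : ∀ n, nehari σ p q K (W n) = 0 := fun n => by
    rw [nehari, mass_shift (hper n), potentialPart_shift (hper n), potentialPart_shift (hper n)]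
    exact (hZ n).2.2
  have hWu : ∀ n, reducedAction σ p q K (W n) = u n := fun n => by
    rw [← hZu, reducedAction, mass_shift (hper n), potentialPart_shift (hper n)]; rfl
  have hWη : ∀ n, η ≤ |avg (W n) 0| := fun n => by
    rw [hWdef]; simp only; rw [avg_comp_shift, zero_add]; exact hs n
  obtain ⟨B, hB⟩ := hu.bddAbove_range
  have hB' : ∀ n, reducedAction σ p q K (W n) ≤ B := fun n => by
    rw [hWu]; exact hB (mem_range_self n)
  set M := max (B / (σ ^ 2 * (1 / 2 - 1 / p))) (B / (1 - q / p))
  have hmass : ∀ n, mass K (W n) ≤ M := fun n =>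
    (mass_le_of_reducedAction_le hσ hp hqp (hB' n)).1.trans (le_max_left _ _)
  have hpot : ∀ n, potentialPart q K (W n) ≤ M := fun n =>
    (mass_le_of_reducedAction_le hσ hp hqp (hB' n)).2.trans (le_max_right _ _)
  obtain ⟨τ, hτ, V, a', b', hV, hweak, ha', hb', hVa⟩ := exists_subseq_weak_limit
    (K := fun _ => K) hW hmass (b := fun n => potentialPart q K (W n))
    (fun n => potentialPart_nonneg _ _ _) hpot
  set U := periodize K V with hUdef
  have hU : CellL2 K U := periodize_cellL2 hK hT hV
  have havg : ∀ φ, Tendsto (fun n => avg (W (τ n)) φ) atTop (𝓝 (avg U φ)) := by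
    refine tendsto_avg_of_weak hK hT (fun n => hW (τ n)) hU fun x y hxy hsub => ?_
    have h1 := hweak _ (memLp_indicator_Ioc_one x y)
    simp only [fun n => intervalIntegral_eq_integral_indicator (K := K) (W (τ n)) hxy hsub]
    convert h1 using 2
    rw [intervalIntegral.integral_of_le hxy, ← integral_indicator measurableSet_Ioc]
    congr 1; ext z
    by_cases hz : z ∈ Ioc x y
    · simp [hz, hUdef, periodize_eq hT V (hsub hz)]
    · simp [hz]
  obtain ⟨k, hk, hkK⟩ := exists_nat_cover hK
  have hsup : ∀ n φ, |avg (W n) φ| ≤ √(k * M) := fun n φ =>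
    ((hW n).abs_avg_le hK hk hkK φ).trans
      (Real.sqrt_le_sqrt (mul_le_mul_of_nonneg_left (hmass n) (Nat.cast_nonneg k)))
  have hconv : ∀ r, 0 < r → Tendsto (fun n => potentialPart r K (W (τ n))) atTop
      (𝓝 (potentialPart r K U)) := by
    intro r hr
    refine tendsto_integral_of_dominated_convergence (fun _ => √(k * M) ^ r)
      (fun n => ((hW _).continuous_abs_avg_rpow hK hr.le).aestronglyMeasurable)
      (integrable_const _) (fun n => Eventually.of_forall fun φ => ?_)
      (Eventually.of_forall fun φ => ?_)
    · rw [Real.norm_of_nonneg (by positivity)]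
      exact Real.rpow_le_rpow (abs_nonneg _) (hsup _ _) hr.le
    · exact (havg φ).abs.rpow_const (Or.inr hr.le)
  have hUm : mass K U ≤ a' := (mass_periodize_le hT hV).trans hVa
  have hU0 : 0 < mass K U := by
    refine hU.mass_pos_of_avg_ne_zero hK (φ := 0) fun h0 => ?_
    have := ge_of_tendsto' (havg 0).abs fun n => hWη (τ n)
    rw [h0, abs_zero] at this; linarith
  have hUq := hconv q (by linarith)
  have hUp := hconv p (by linarith)
  -- Both potential parts converge, so only the mass can drop in the limit, and it enters `nehari`
  -- with a positive coefficient.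
  have hUn : nehari σ p q K U ≤ 0 := by
    have h1 := ((ha'.const_mul (σ ^ 2)).add (hUq.const_mul q)).sub (hUp.const_mul p)
    have h2 : σ ^ 2 * a' + q * potentialPart q K U - p * potentialPart p K U = 0 :=
      tendsto_nhds_unique h1 (by
        refine tendsto_const_nhds.congr fun n => ?_
        exact (hWn (τ n)).symm)
    unfold nehari
    have := mul_le_mul_of_nonneg_left hUm hσ.le
    linarith
  have c1 : 0 < 1 / 2 - 1 / p := by
    rw [sub_pos, div_lt_div_iff₀ (by linarith) (by norm_num)]; linarith
  have hUE : reducedAction σ p q K U ≤ sInf E := by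
    have h1 := (ha'.const_mul (σ ^ 2 * (1 / 2 - 1 / p))).add (hUq.const_mul (1 - q / p))
    have h2 : σ ^ 2 * (1 / 2 - 1 / p) * a' + (1 - q / p) * potentialPart q K U = sInf E :=
      tendsto_nhds_unique h1 ((hu.comp hτ.tendsto_atTop).congr fun n => (hWu (τ n)).symm)
    rw [← h2, reducedAction]
    have := mul_le_mul_of_nonneg_left hUm (mul_pos hσ c1).le
    linarith
  exact ⟨U, isNehariMinimizer_of_nehari_nonpos hσ hp hq hqp
    (mem_ansatz_of_ne_top hp hq hK hT hU) hU0 hUn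
    fun Y hY hYm hYn => hUE.trans (csInf_le hbdd ⟨Y, ⟨hY, hYm, hYn⟩, rfl⟩)⟩

/-! ### Localization estimates on the line -/

lemma tendsto_intervalIntegral_translate_atTop {f : ℝ → ℝ} (hf : Integrable f volume) (c d : ℝ) :
    Tendsto (fun R => ∫ x in (R + c)..(R + d), f x) atTop (𝓝 0) := by
  have h := intervalIntegral_tendsto_integral_Ioi 0 hf.integrableOn (tendsto_id (α := ℝ))
  have h1 := (h.comp (tendsto_atTop_add_const_right atTop d tendsto_id)).sub
    (h.comp (tendsto_atTop_add_const_right atTop c tendsto_id))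
  rw [sub_self] at h1
  refine h1.congr fun R => ?_
  simp only [Function.comp_apply, id]
  rw [intervalIntegral.integral_interval_sub_left hf.intervalIntegrable hf.intervalIntegrable]

lemma tendsto_intervalIntegral_translate_neg_atTop {f : ℝ → ℝ} (hf : Integrable f volume)
    (c d : ℝ) : Tendsto (fun R => ∫ x in (-R + c)..(-R + d), f x) atTop (𝓝 0) := by
  have h := tendsto_intervalIntegral_translate_atTop hf.comp_neg (-d) (-c)
  refine h.congr fun R => ?_
  rw [intervalIntegral.integral_comp_neg]
  congr 1 <;> ring

lemma tendsto_intervalIntegral_symm {f : ℝ → ℝ} (hf : Integrable f volume) (c : ℝ) :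
    Tendsto (fun R => ∫ x in (-(R - c))..(R - c), f x) atTop (𝓝 (∫ x, f x)) := by
  have h : Tendsto (fun R : ℝ => R - c) atTop atTop := tendsto_atTop_add_const_right _ (-c) tendsto_id
  exact intervalIntegral_tendsto_integral hf (tendsto_neg_atTop_atBot.comp h) h

/-- An average is controlled by the `L²` norm on any interval containing the window. -/
lemma abs_avg_le_sqrt {W : ℝ → ℝ} (hW : ∀ x y, IntervalIntegrable W volume x y)
    (hW2 : ∀ x y, IntervalIntegrable (fun s => W s ^ 2) volume x y) {φ x y : ℝ}
    (hx : x ≤ φ - 1 / 2) (hy : φ + 1 / 2 ≤ y) : |avg W φ| ≤ √(∫ s in x..y, W s ^ 2) := by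
  refine Real.abs_le_sqrt ((sq_avg_le hW hW2 φ).trans ?_)
  exact intervalIntegral.integral_mono_interval hx (by linarith) hy
    (Eventually.of_forall fun _ => sq_nonneg _) (hW2 _ _)

lemma avg_congr_of_Ioc {W V : ℝ → ℝ} {φ : ℝ}
    (h : ∀ s ∈ Ioc (φ - 1 / 2) (φ + 1 / 2), W s = V s) : avg W φ = avg V φ := by
  refine intervalIntegral.integral_congr_ae (Eventually.of_forall fun s hs => h s ?_)
  rwa [uIoc_of_le (by linarith)] at hs

/-! ### Periodic approximation of functions on the line -/

lemma tendsto_mass_periodize {U : ℝ → ℝ} (hU : CellL2 ∞ U) :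
    Tendsto (fun κ => mass (ENNReal.ofReal κ) (periodize (ENNReal.ofReal κ) U)) atTop
      (𝓝 (mass ∞ U)) := by
  have hi := hU.integrable_sq
  rw [cellMeasure_top] at hi
  have h := tendsto_intervalIntegral_symm hi 0
  rw [mass, cellMeasure_top]
  refine h.congr' ?_
  filter_upwards [eventually_ge_atTop 0] with κ hκ
  have e : mass (ENNReal.ofReal κ) (periodize (ENNReal.ofReal κ) U)
      = ∫ x, U x ^ 2 ∂(cellMeasure (ENNReal.ofReal κ)) :=
    integral_congr_ae (by
      filter_upwards [periodize_ae_eq ENNReal.ofReal_ne_top U] with x hx; rw [hx])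
  rw [e, integral_cellMeasure_of_ne_top ENNReal.ofReal_ne_top, ENNReal.toReal_ofReal hκ, sub_zero]

/-- The averages of `U` and of its periodization differ only near the ends of the cell. There the
averages of the periodization are bounded by the `L²` norm of `U` near `±κ`, which tends to zero. -/
lemma tendsto_potentialPart_periodize {U : ℝ → ℝ} (hU : CellL2 ∞ U) {r : ℝ} (hr : 0 < r)
    (hUr : Integrable (fun φ => |avg U φ| ^ r) volume) :
    Tendsto (fun κ => potentialPart r (ENNReal.ofReal κ) (periodize (ENNReal.ofReal κ) U)) atTop
      (𝓝 (potentialPart r ∞ U)) := by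
  have hi := hU.integrable_sq
  have hU2 := hU.memLp
  rw [cellMeasure_top] at hi hU2
  set ε : ℝ → ℝ := fun κ => √((∫ x in (κ + -1)..(κ + 0), U x ^ 2)
    + ∫ x in (-κ + 0)..(-κ + 1), U x ^ 2) with hε
  have hε0 : Tendsto (fun κ => ε κ ^ r) atTop (𝓝 0) := by
    have h := ((tendsto_intervalIntegral_translate_atTop hi (-1) 0).add
      (tendsto_intervalIntegral_translate_neg_atTop hi 0 1)).sqrt.rpow_const
      (p := r) (Or.inr hr.le)
    rwa [add_zero, Real.sqrt_zero, Real.zero_rpow hr.ne'] at h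
  set B : ℝ → ℝ := fun κ => ∫ φ in (κ - 1 / 2)..(κ + 1 / 2),
    |avg (periodize (ENNReal.ofReal κ) U) φ| ^ r with hBdef
  have hsplit : ∀ κ, 1 ≤ κ →
      potentialPart r (ENNReal.ofReal κ) (periodize (ENNReal.ofReal κ) U)
        = (∫ φ in (-(κ - 1 / 2))..(κ - 1 / 2), |avg U φ| ^ r) + B κ ∧ |B κ| ≤ ε κ ^ r := by
    intro κ hκ
    set K := ENNReal.ofReal κ with hKdef
    have hK : 0 < K := ENNReal.ofReal_pos.2 (by linarith)
    have hT : K ≠ ∞ := ENNReal.ofReal_ne_top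
    have hKr : K.toReal = κ := ENNReal.toReal_ofReal (by linarith)
    set P := periodize K U with hP
    have hPL : CellL2 K P := periodize_cellL2 hK hT hU2
    have hPeq : ∀ s ∈ Ioc (-κ) κ, P s = U s := fun s hs =>
      periodize_eq hT U (by rwa [cell_of_ne_top hT, hKr])
    have hPper := hPL.periodic hT
    rw [hKr] at hPper
    have hc := hPL.continuous_abs_avg_rpow hK hr.le
    constructor
    · have hper := (hPL.periodic.avg.map fun w => |w| ^ r) hT
      rw [hKr] at hper
      rw [potentialPart, integral_cellMeasure_of_ne_top hT, hKr]
      -- Shifting the period by `1 / 2` joins the two end strips into one interval of length one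
      -- around `κ`.
      have h1 := hper.intervalIntegral_add_eq (-κ) (-(κ - 1 / 2))
      rw [show -κ + 2 * κ = κ by ring, show -(κ - 1 / 2) + 2 * κ = κ + 1 / 2 by ring] at h1
      rw [h1, ← intervalIntegral.integral_add_adjacent_intervals
        (hc.intervalIntegrable _ (κ - 1 / 2)) (hc.intervalIntegrable _ _)]
      congr 1
      refine intervalIntegral.integral_congr fun φ hφ => ?_
      rw [uIcc_of_le (by linarith)] at hφ
      rw [avg_congr_of_Ioc (V := U) fun s hs => hPeq s
        ⟨by linarith [hφ.1, hs.1], by linarith [hφ.2, hs.2]⟩]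
    -- All windows centred in the strip lie in `[κ - 1, κ + 1]`; by periodicity its right half
    -- carries the values of `U` just after `-κ`.
    · have hwin : ∫ s in (κ - 1)..(κ + 1), P s ^ 2
          = (∫ x in (κ + -1)..(κ + 0), U x ^ 2) + ∫ x in (-κ + 0)..(-κ + 1), U x ^ 2 := by
        have hii := hPL.intervalIntegrable_sq hK
        rw [← intervalIntegral.integral_add_adjacent_intervals (hii (κ - 1) κ) (hii _ _)]
        congr 1
        · rw [← sub_eq_add_neg, add_zero]
          refine intervalIntegral.integral_congr_ae (Eventually.of_forall fun s hs => ?_)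
          rw [uIoc_of_le (by linarith)] at hs
          rw [hPeq s ⟨by linarith [hs.1], hs.2⟩]
        · have e1 : ∫ s in κ..(κ + 1), P s ^ 2
              = ∫ s in (-κ + 0)..(-κ + 1), P (s + 2 * κ) ^ 2 := by
            rw [intervalIntegral.integral_comp_add_right (fun s => P s ^ 2)]
            congr 1 <;> ring
          rw [e1]
          refine intervalIntegral.integral_congr_ae (Eventually.of_forall fun s hs => ?_)
          rw [uIoc_of_le (by linarith)] at hs
          rw [hPper s, hPeq s ⟨by linarith [hs.1], by linarith [hs.2]⟩]
      have := intervalIntegral.norm_integral_le_of_norm_le_const (a := κ - 1 / 2)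
        (b := κ + 1 / 2) (f := fun φ => |avg P φ| ^ r) (C := ε κ ^ r) fun φ hφ => by
          rw [uIoc_of_le (by linarith)] at hφ
          rw [Real.norm_of_nonneg (by positivity)]
          refine Real.rpow_le_rpow (abs_nonneg _) ?_ hr.le
          simp only [hε]
          rw [← hwin]
          exact abs_avg_le_sqrt (hPL.intervalIntegrable hK) (hPL.intervalIntegrable_sq hK)
            (by linarith [hφ.1]) (by linarith [hφ.2])
      rw [Real.norm_eq_abs] at this
      refine this.trans (le_of_eq ?_)
      rw [show κ + 1 / 2 - (κ - 1 / 2) = 1 by ring, abs_one, mul_one]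
  have hB : Tendsto B atTop (𝓝 0) := by
    refine squeeze_zero_norm' ?_ hε0
    filter_upwards [eventually_ge_atTop 1] with κ hκ using (hsplit κ hκ).2
  have hmain := (tendsto_intervalIntegral_symm hUr (1 / 2)).add hB
  rw [add_zero] at hmain
  rw [potentialPart, cellMeasure_top]
  refine hmain.congr' ?_
  filter_upwards [eventually_ge_atTop 1] with κ hκ using ((hsplit κ hκ).1).symm

lemma tendsto_reducedAction_periodize {σ p q : ℝ} (hp : 2 < p) (hq : 1 < q) {U : ℝ → ℝ}
    (hU : U ∈ ansatz p q ∞) :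
    Tendsto (fun κ => reducedAction σ p q (ENNReal.ofReal κ) (periodize (ENNReal.ofReal κ) U))
      atTop (𝓝 (reducedAction σ p q ∞ U)) := by
  obtain ⟨h1, h2⟩ := (mem_ansatz_iff hp hq ENNReal.zero_lt_top).1 hU
  rw [cellMeasure_top] at h2
  exact ((tendsto_mass_periodize h1).const_mul _).add
    ((tendsto_potentialPart_periodize h1 (by linarith) h2).const_mul _)

lemma tendsto_nehari_periodize {σ p q : ℝ} (hp : 2 < p) (hq : 1 < q) {U : ℝ → ℝ}
    (hU : U ∈ ansatz p q ∞) :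
    Tendsto (fun κ => nehari σ p q (ENNReal.ofReal κ) (periodize (ENNReal.ofReal κ) U))
      atTop (𝓝 (nehari σ p q ∞ U)) := by
  obtain ⟨h1, h2⟩ := (mem_ansatz_iff hp hq ENNReal.zero_lt_top).1 hU
  have h3 := h1.integrable_abs_avg_rpow ENNReal.zero_lt_top hp.le
  rw [cellMeasure_top] at h2 h3
  exact (((tendsto_mass_periodize h1).const_mul _).add
    ((tendsto_potentialPart_periodize h1 (by linarith) h2).const_mul _)).sub
    ((tendsto_potentialPart_periodize h1 (by linarith) h3).const_mul _)

/-- The least action on a large cell is asymptotically bounded by the action of any function on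
the line with negative Nehari functional. -/
lemma eventually_reducedAction_le {σ p q : ℝ} (hσ : 0 < σ ^ 2) (hp : 2 < p) (hq : 1 < q)
    (hqp : q < p) {U : ℝ → ℝ} (hU : U ∈ ansatz p q ∞) (hm : 0 < mass ∞ U)
    (hn : nehari σ p q ∞ U < 0) :
    ∀ᶠ κ in atTop, ∀ W, IsNehariMinimizer σ p q (ENNReal.ofReal κ) W →
      reducedAction σ p q (ENNReal.ofReal κ) W
        ≤ reducedAction σ p q (ENNReal.ofReal κ) (periodize (ENNReal.ofReal κ) U) := by
  obtain ⟨h1, -⟩ := (mem_ansatz_iff hp hq ENNReal.zero_lt_top).1 hU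
  have h2 := h1.memLp
  rw [cellMeasure_top] at h2
  -- The strict inequalities `hm` and `hn` survive periodization on large cells, so the
  -- periodization is an admissible competitor.
  filter_upwards [eventually_gt_atTop 0,
    (tendsto_mass_periodize h1).eventually (lt_mem_nhds hm),
    (tendsto_nehari_periodize hp hq hU).eventually (gt_mem_nhds hn)] with κ hκ hκm hκn W hW
  have hK : 0 < ENNReal.ofReal κ := ENNReal.ofReal_pos.2 hκ
  exact hW.le_of_nehari_nonpos hσ hp hq hqp (mem_ansatz_of_ne_top hp hq hK ENNReal.ofReal_ne_top
    (periodize_cellL2 hK ENNReal.ofReal_ne_top h2)) hκm hκn.le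

lemma CellL2.potentialPart_top_pos {W : ℝ → ℝ} (hW : CellL2 ∞ W) {r φ : ℝ} (hr : 2 ≤ r)
    (h : avg W φ ≠ 0) : 0 < potentialPart r ∞ W := by
  have hi := hW.integrable_abs_avg_rpow ENNReal.zero_lt_top hr
  have hc := hW.continuous_abs_avg_rpow ENNReal.zero_lt_top (by linarith : 0 ≤ r)
  rw [potentialPart]
  rw [cellMeasure_top] at hi ⊢
  refine (integral_pos_iff_support_of_nonneg (fun x => by positivity) hi).2 ?_
  refine hc.isOpen_support.measure_pos volume ⟨φ, ?_⟩
  exact (Real.rpow_pos_of_pos (abs_pos.2 h) r).ne'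

lemma exists_nehari_neg_top {σ p q : ℝ} (hp : 2 < p) (hq : 1 < q) (hqp : q < p) :
    ∃ U ∈ ansatz p q ∞, 0 < mass ∞ U ∧ nehari σ p q ∞ U < 0 := by
  set V : ℝ → ℝ := (Icc (-1 : ℝ) 1).indicator fun _ => 1 with hV
  have hVb : ∀ x, |V x| ≤ 1 := by
    intro x
    by_cases hx : x ∈ Icc (-1 : ℝ) 1
    · rw [hV, indicator_of_mem hx]; simp
    · rw [hV, indicator_of_notMem hx]; simp
  have hVm := (mem_ansatz_top_of_bounded (V := V) (C := 1) (R := 1) hp hq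
    (aestronglyMeasurable_const.indicator measurableSet_Icc) hVb
    fun x hx => indicator_of_notMem (s := Icc (-1 : ℝ) 1)
      (fun h => absurd hx (not_lt.2 (abs_le.2 ⟨h.1, h.2⟩))) _).1
  have hVL := ((mem_ansatz_iff hp hq ENNReal.zero_lt_top).1 hVm).1
  have h0 : avg V 0 ≠ 0 := by
    have : avg V 0 = avg (fun _ => 1) 0 := avg_congr_of_Ioc fun s hs =>
      indicator_of_mem (s := Icc (-1 : ℝ) 1) ⟨by linarith [hs.1], by linarith [hs.2]⟩ _
    rw [this]; simp [avg]
  obtain ⟨t, ht, hneg⟩ := exists_fibre_deriv_neg (S := σ ^ 2) (a := mass ∞ V)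
    (b := potentialPart q ∞ V) (q := q) hp hqp (hVL.potentialPart_top_pos hp.le h0)
  refine ⟨t • V, smul_mem_ansatz hVm t, ?_, ?_⟩
  · rw [mass_smul]
    have := hVL.mass_pos_of_avg_ne_zero ENNReal.zero_lt_top h0
    positivity
  · rw [nehari_smul _ _ _ _ ht.le]; exact hneg

/-- One fixed function on the line with negative Nehari functional, periodized, bounds the least
action on all large cells. The bound serves both compactness and nonconstancy. -/
lemma exists_reducedAction_bound {σ p q : ℝ} (hσ : 0 < σ ^ 2) (hp : 2 < p) (hq : 1 < q)
    (hqp : q < p) :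
    ∃ κ₀ B : ℝ, 1 ≤ κ₀ ∧ ∀ κ, κ₀ ≤ κ → ∀ W, IsNehariMinimizer σ p q (ENNReal.ofReal κ) W →
      reducedAction σ p q (ENNReal.ofReal κ) W ≤ B := by
  obtain ⟨U, hU, hm, hn⟩ := exists_nehari_neg_top (σ := σ) hp hq hqp
  have h := (eventually_reducedAction_le hσ hp hq hqp hU hm hn).and
    ((tendsto_reducedAction_periodize (σ := σ) hp hq hU).eventually
      (gt_mem_nhds (lt_add_one (reducedAction σ p q ∞ U))))
  obtain ⟨κ₀, hκ₀⟩ := eventually_atTop.1 h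
  exact ⟨max κ₀ 1, _, le_max_right _ _, fun κ hκ W hW =>
    ((hκ₀ κ ((le_max_left _ _).trans hκ)).1 W hW).trans
      (hκ₀ κ ((le_max_left _ _).trans hκ)).2.le⟩

/-- A function on the line that satisfies the traveling wave equation tested with its own
truncations has vanishing Nehari functional. -/
lemma nehari_top_eq_zero {σ p q : ℝ} (hp : 2 < p) (hq : 1 < q) (hqp : q < p) {W : ℝ → ℝ}
    (hW : W ∈ ansatz p q ∞)
    (h : ∀ R : ℝ, 0 < R → σ ^ 2 * ∫ x in (-R)..R, W x ^ 2
      = ∫ x in (-R)..R, avg (force p q W) x * W x) :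
    nehari σ p q ∞ W = 0 := by
  have hK : (0 : ℝ≥0∞) < ∞ := ENNReal.zero_lt_top
  obtain ⟨hWL, hWq⟩ := (mem_ansatz_iff hp hq hK).1 hW
  have hWp := hWL.integrable_abs_avg_rpow hK hp.le
  have hi := hWL.integrable_sq
  have hW2 := hWL.memLp
  rw [cellMeasure_top] at hWq hWp hi hW2
  obtain ⟨S, hS0, hS⟩ := hWL.exists_abs_avg_le hK
  set C := p * S ^ (p - 1) + q * S ^ (q - 1) with hC
  have hG : ∀ φ, |force p q W φ| ≤ C := fun φ => abs_force_le hq hqp (hS φ)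
  have hC0 : 0 ≤ C := (abs_nonneg _).trans (hG 0)
  have hGc := hWL.continuous_force (p := p) hq hqp hK
  have hGW : ∀ φ, force p q W φ * avg W φ = p * |avg W φ| ^ p - q * |avg W φ| ^ q := by
    intro φ
    rw [force, sub_mul, Psi_mul_self hq, Psi_mul_self (hq.trans hqp)]
  have hGWi : Integrable (fun φ => force p q W φ * avg W φ) volume := by
    simp only [hGW]
    exact (hWp.const_mul p).sub (hWq.const_mul q)
  -- `W` need not be integrable on the line, so symmetry of `avg` is applied to truncations. Their
  -- averages differ from `avg W` only in unit intervals around `±R`, whose contributions vanish as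
  -- `R → ∞`.
  set T : ℝ → ℝ → ℝ := fun R => (Ioc (-R) R).indicator W with hTdef
  have hTL : ∀ R, CellL2 ∞ (T R) := fun R =>
    ⟨fun h => absurd rfl h, by rw [cellMeasure_top]; exact hW2.indicator measurableSet_Ioc⟩
  have hT2 : ∀ R x, T R x ^ 2 ≤ W x ^ 2 := by
    intro R x
    by_cases hx : x ∈ Ioc (-R) R
    · rw [hTdef]; simp only; rw [indicator_of_mem hx]
    · rw [hTdef]; simp only; rw [indicator_of_notMem hx]; nlinarith [sq_nonneg (W x)]
  set ε₁ : ℝ → ℝ := fun R => √(∫ x in (R + -1)..(R + 1), W x ^ 2) with hε₁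
  set ε₂ : ℝ → ℝ := fun R => √(∫ x in (-R + -1)..(-R + 1), W x ^ 2) with hε₂
  have hε₁0 : Tendsto (fun R => C * ε₁ R) atTop (𝓝 0) := by
    simpa using (tendsto_intervalIntegral_translate_atTop hi (-1) 1).sqrt.const_mul C
  have hε₂0 : Tendsto (fun R => C * ε₂ R) atTop (𝓝 0) := by
    simpa using (tendsto_intervalIntegral_translate_neg_atTop hi (-1) 1).sqrt.const_mul C
  have hTavg : ∀ R φ x y, x ≤ φ - 1 / 2 → φ + 1 / 2 ≤ y →
      |avg (T R) φ| ≤ √(∫ s in x..y, W s ^ 2) := by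
    intro R φ x y hx hy
    refine (abs_avg_le_sqrt ((hTL R).intervalIntegrable hK) ((hTL R).intervalIntegrable_sq hK)
      hx hy).trans (Real.sqrt_le_sqrt ?_)
    exact intervalIntegral.integral_mono_on (by linarith) ((hTL R).intervalIntegrable_sq hK _ _)
      (hWL.intervalIntegrable_sq hK _ _) fun s _ => hT2 R s
  set f : ℝ → ℝ → ℝ := fun R φ => force p q W φ * avg (T R) φ with hf
  have hfc : ∀ R, Continuous (f R) := fun R => hGc.mul ((hTL R).continuous_avg hK)
  set B₁ : ℝ → ℝ := fun R => ∫ φ in (R - 1 / 2)..(R + 1 / 2), f R φ with hB₁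
  set B₂ : ℝ → ℝ := fun R => ∫ φ in (-R - 1 / 2)..(-R + 1 / 2), f R φ with hB₂
  have hsplit : ∀ R, 1 ≤ R → σ ^ 2 * ∫ x in (-(R - 0))..(R - 0), W x ^ 2
      = B₂ R + (∫ φ in (-(R - 1 / 2))..(R - 1 / 2), force p q W φ * avg W φ) + B₁ R := by
    intro R hR
    rw [sub_zero, h R (by linarith)]
    have hTi : Integrable (T R) volume := by
      refine (integrable_indicator_iff measurableSet_Ioc).2 ?_
      exact (intervalIntegrable_iff_integrableOn_Ioc_of_le (by linarith)).1
        (hWL.intervalIntegrable hK _ _)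
    have hsym := integral_mul_avg hK hGc hG (fun h => absurd rfl h)
      (fun h => absurd rfl h) (V := T R) (by rwa [cellMeasure_top])
    rw [cellMeasure_top] at hsym
    have e1 : ∫ x in (-R)..R, avg (force p q W) x * W x = ∫ x, avg (force p q W) x * T R x := by
      rw [intervalIntegral.integral_of_le (by linarith), ← integral_indicator measurableSet_Ioc]
      congr 1; ext x
      by_cases hx : x ∈ Ioc (-R) R <;> simp [hTdef, hx]
    have hsupp : Function.support (f R) ⊆ Ioc (-R - 1 / 2) (R + 1 / 2) := by
      intro φ hφ
      by_contra hn
      refine hφ ?_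
      have : avg (T R) φ = avg (fun _ => 0) φ := by
        refine avg_congr_of_Ioc fun s hs => indicator_of_notMem (fun hs' => hn ?_) _
        exact ⟨by linarith [hs.2, hs'.1], by linarith [hs.1, hs'.2]⟩
      simp only [hf, this]
      simp [avg]
    rw [e1, ← hsym, ← intervalIntegral.integral_eq_integral_of_support_subset hsupp,
      ← intervalIntegral.integral_add_adjacent_intervals
        ((hfc R).intervalIntegrable _ (R - 1 / 2)) ((hfc R).intervalIntegrable _ _),
      ← intervalIntegral.integral_add_adjacent_intervals
        ((hfc R).intervalIntegrable _ (-R + 1 / 2)) ((hfc R).intervalIntegrable _ _)]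
    congr 2
    rw [show -(R - 1 / 2) = -R + 1 / 2 by ring]
    refine intervalIntegral.integral_congr fun φ hφ => ?_
    rw [uIcc_of_le (by linarith)] at hφ
    simp only [hf]
    congr 1
    exact avg_congr_of_Ioc fun s hs => indicator_of_mem (s := Ioc (-R) R)
      ⟨by linarith [hφ.1, hs.1], by linarith [hφ.2, hs.2]⟩ _
  have hBound : ∀ R c D, (∀ φ ∈ Ioc (c - 1 / 2) (c + 1 / 2), |avg (T R) φ| ≤ D) →
      ‖∫ φ in (c - 1 / 2)..(c + 1 / 2), f R φ‖ ≤ C * D := by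
    intro R c D hD
    have := intervalIntegral.norm_integral_le_of_norm_le_const (a := c - 1 / 2)
      (b := c + 1 / 2) (f := f R) (C := C * D) fun φ hφ => by
        rw [uIoc_of_le (by linarith)] at hφ
        rw [Real.norm_eq_abs, abs_mul]
        exact mul_le_mul (hG φ) (hD φ hφ) (abs_nonneg _) hC0
    refine this.trans (le_of_eq ?_)
    rw [show c + 1 / 2 - (c - 1 / 2) = 1 by ring, abs_one, mul_one]
  have hB₁0 : Tendsto B₁ atTop (𝓝 0) :=
    squeeze_zero_norm (fun R => hBound R R _ fun φ hφ =>
      hTavg R φ _ _ (by linarith [hφ.1]) (by linarith [hφ.2])) hε₁0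
  have hB₂0 : Tendsto B₂ atTop (𝓝 0) :=
    squeeze_zero_norm (fun R => hBound R (-R) _ fun φ hφ =>
      hTavg R φ _ _ (by linarith [hφ.1]) (by linarith [hφ.2])) hε₂0
  have hlim1 := (tendsto_intervalIntegral_symm hi 0).const_mul (σ ^ 2)
  have hlim2 := (hB₂0.add (tendsto_intervalIntegral_symm hGWi (1 / 2))).add hB₁0
  have heq := tendsto_nhds_unique (hlim1.congr' (by
    filter_upwards [eventually_ge_atTop 1] with R hR using hsplit R hR)) hlim2
  simp only [hGW] at heq
  rw [integral_sub (hWp.const_mul p) (hWq.const_mul q), integral_const_mul,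
    integral_const_mul] at heq
  simp only [nehari, mass, potentialPart, cellMeasure_top]
  linarith

/-! ### Convergence to solitary waves -/

lemma tendsto_avg_force {p q : ℝ} (hq : 1 < q) (hqp : q < p) {K : ℕ → ℝ≥0∞}
    (hK : ∀ n, 0 < K n) {W : ℕ → ℝ → ℝ} {V : ℝ → ℝ} (hW : ∀ n, CellL2 (K n) (W n))
    {S : ℝ} (hS : ∀ n φ, |avg (W n) φ| ≤ S)
    (h : ∀ φ, Tendsto (fun n => avg (W n) φ) atTop (𝓝 (avg V φ))) (φ : ℝ) :
    Tendsto (fun n => avg (force p q (W n)) φ) atTop (𝓝 (avg (force p q V) φ)) := by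
  refine intervalIntegral.tendsto_integral_filter_of_dominated_convergence
    (fun _ => p * S ^ (p - 1) + q * S ^ (q - 1))
    (Eventually.of_forall fun n => ((hW n).continuous_force hq hqp (hK n)).aestronglyMeasurable)
    (Eventually.of_forall fun n => Eventually.of_forall fun x _ => abs_force_le hq hqp (hS n x))
    (by simp) (Eventually.of_forall fun x _ => ?_)
  exact (((continuous_Psi (hq.trans hqp)).tendsto _).comp (h x)).sub
    (((continuous_Psi hq).tendsto _).comp (h x))

/-- Fatou's lemma for the potential part. -/
lemma potentialPart_top_le_of_tendsto {r : ℝ} (hr : 0 < r) {K : ℕ → ℝ≥0∞} (hK : ∀ n, 0 < K n)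
    (hcell : ∀ R : ℝ, ∀ᶠ n in atTop, Ioc (-R) R ⊆ cell (K n))
    {W : ℕ → ℝ → ℝ} {V : ℝ → ℝ} (hW : ∀ n, CellL2 (K n) (W n)) (hV : CellL2 ∞ V)
    (hWr : ∀ n, Integrable (fun φ => |avg (W n) φ| ^ r) (cellMeasure (K n)))
    {S : ℝ} (hS : ∀ n φ, |avg (W n) φ| ≤ S)
    (h : ∀ φ, Tendsto (fun n => avg (W n) φ) atTop (𝓝 (avg V φ))) {b : ℝ}
    (hb : Tendsto (fun n => potentialPart r (K n) (W n)) atTop (𝓝 b)) :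
    Integrable (fun φ => |avg V φ| ^ r) volume ∧ potentialPart r ∞ V ≤ b := by
  have hc := hV.continuous_abs_avg_rpow ENNReal.zero_lt_top hr.le
  -- On bounded intervals the sup bound gives dominated convergence, and the cells eventually
  -- contain each such interval; exhausting the line yields the claim.
  have hR : ∀ R : ℝ, 0 ≤ R → ∫ φ in (-R)..R, |avg V φ| ^ r ≤ b := by
    intro R hR0
    have h1 : Tendsto (fun n => ∫ φ in (-R)..R, |avg (W n) φ| ^ r) atTop
        (𝓝 (∫ φ in (-R)..R, |avg V φ| ^ r)) := by
      refine intervalIntegral.tendsto_integral_filter_of_dominated_convergence (fun _ => S ^ r)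
        (Eventually.of_forall fun n =>
          ((hW n).continuous_abs_avg_rpow (hK n) hr.le).aestronglyMeasurable)
        (Eventually.of_forall fun n => Eventually.of_forall fun x _ => ?_)
        (by simp) (Eventually.of_forall fun x _ => (h x).abs.rpow_const (Or.inr hr.le))
      rw [Real.norm_of_nonneg (by positivity)]
      exact Real.rpow_le_rpow (abs_nonneg _) (hS n x) hr.le
    refine le_of_tendsto_of_tendsto h1 hb ?_
    filter_upwards [hcell R] with n hn
    rw [intervalIntegral.integral_of_le (by linarith), potentialPart, cellMeasure]
    exact setIntegral_mono_set (hWr n) (Eventually.of_forall fun x => by positivity)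
      hn.eventuallyLE
  have hseq : Tendsto (fun n : ℕ => (n : ℝ)) atTop atTop := tendsto_natCast_atTop_atTop
  have hint : Integrable (fun φ => |avg V φ| ^ r) volume := by
    refine integrable_of_intervalIntegral_norm_bounded b
      (fun n : ℕ => (hc.integrableOn_Ioc (a := -(n : ℝ)) (b := n)))
      (tendsto_neg_atTop_atBot.comp hseq) hseq (Eventually.of_forall fun n => ?_)
    have e : ∀ φ, ‖|avg V φ| ^ r‖ = |avg V φ| ^ r := fun φ =>
      Real.norm_of_nonneg (by positivity)
    simp only [e]
    exact hR n n.cast_nonneg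
  refine ⟨hint, ?_⟩
  rw [potentialPart, cellMeasure_top]
  exact le_of_tendsto (intervalIntegral_tendsto_integral hint
    (tendsto_neg_atTop_atBot.comp hseq) hseq) (Eventually.of_forall fun n => hR n n.cast_nonneg)

lemma tendsto_eLpNorm_two_zero {f : ℕ → ℝ → ℝ} (hf : ∀ n, MemLp (f n) 2 volume)
    (h : Tendsto (fun n => ∫ x, f n x ^ 2) atTop (𝓝 0)) :
    Tendsto (fun n => eLpNorm (f n) 2 volume) atTop (𝓝 0) := by
  have e : ∀ n, eLpNorm (f n) 2 volume = ENNReal.ofReal (√(∫ x, f n x ^ 2)) := by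
    intro n
    rw [(hf n).eLpNorm_eq_integral_rpow_norm (by norm_num) (by norm_num)]
    simp [Real.sqrt_eq_rpow]
  simp only [e]
  have := ENNReal.tendsto_ofReal h.sqrt
  simpa using this

lemma tendsto_reducedAction_smul {σ p q : ℝ} (U : ℝ → ℝ) :
    Tendsto (fun t : ℝ => reducedAction σ p q ∞ (t • U)) (𝓝[>] 1)
      (𝓝 (reducedAction σ p q ∞ U)) := by
  have h : Tendsto (fun t : ℝ => σ ^ 2 * (1 / 2 - 1 / p) * (t ^ 2 * mass ∞ U)
      + (1 - q / p) * (t ^ q * potentialPart q ∞ U)) (𝓝[>] 1)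
      (𝓝 (σ ^ 2 * (1 / 2 - 1 / p) * ((1 : ℝ) ^ 2 * mass ∞ U)
      + (1 - q / p) * ((1 : ℝ) ^ q * potentialPart q ∞ U))) := by
    have hid : Tendsto (fun t : ℝ => t) (𝓝[>] 1) (𝓝 1) := nhdsWithin_le_nhds
    exact (((hid.pow 2).mul_const _).const_mul _).add
      (((hid.rpow_const (Or.inl one_ne_zero)).mul_const _).const_mul _)
  rw [one_pow, Real.one_rpow, one_mul, one_mul] at h
  refine h.congr' ?_
  filter_upwards [self_mem_nhdsWithin] with t ht
  have ht0 : (0 : ℝ) ≤ t := by linarith [mem_Ioi.1 ht]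
  rw [reducedAction, mass_smul, potentialPart_smul _ _ ht0]

/-- Along a sequence of cells that exhaust the line, Nehari minimizers converge strongly to a
Nehari minimizer on the line, up to translations and subsequences. -/
theorem exists_tendsto_isNehariMinimizer {σ p q : ℝ} (hσ : 0 < σ ^ 2) (hp : 2 < p) (hq : 1 < q)
    (hqp : q < p) {κ₀ B : ℝ} (hκ₀ : 1 ≤ κ₀)
    (hB : ∀ κ, κ₀ ≤ κ → ∀ W, IsNehariMinimizer σ p q (ENNReal.ofReal κ) W →
      reducedAction σ p q (ENNReal.ofReal κ) W ≤ B)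
    {κ : ℕ → ℝ} (hκ : ∀ n, κ₀ ≤ κ n) (hκlim : Tendsto κ atTop atTop) :
    ∃ τ : ℕ → ℕ, StrictMono τ ∧ ∃ (W : ℕ → ℝ → ℝ) (V : ℝ → ℝ),
      (∀ n, IsNehariMinimizer σ p q (ENNReal.ofReal (κ (τ n))) (W n)) ∧
      IsNehariMinimizer σ p q ∞ V ∧
      Tendsto (fun n => eLpNorm (V - (cell (ENNReal.ofReal (κ (τ n)))).indicator (W n)) 2 volume)
        atTop (𝓝 0) := by
  have hTop : (0 : ℝ≥0∞) < ∞ := ENNReal.zero_lt_top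
  have hKpos : ∀ n, 0 < ENNReal.ofReal (κ n) := fun n =>
    ENNReal.ofReal_pos.2 (by linarith [hκ n])
  have hKreal : ∀ n, (ENNReal.ofReal (κ n)).toReal = κ n := fun n =>
    ENNReal.toReal_ofReal (by linarith [hκ n])
  have hcellR : ∀ R : ℝ, ∀ᶠ n in atTop, Ioc (-R) R ⊆ cell (ENNReal.ofReal (κ n)) := by
    intro R
    filter_upwards [hκlim.eventually_ge_atTop R] with n hn
    rw [cell_of_ne_top ENNReal.ofReal_ne_top, hKreal]
    exact Ioc_subset_Ioc (by linarith) hn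
  obtain ⟨η, hη, hηp⟩ := exists_pos_mul_rpow_lt hσ hp
  -- The translated minimizers have an average of size at least `η` at the origin, which excludes a
  -- vanishing weak limit.
  have hex : ∀ n, ∃ W, IsNehariMinimizer σ p q (ENNReal.ofReal (κ n)) W ∧ η ≤ |avg W 0| := by
    intro n
    obtain ⟨Z, hZ⟩ := exists_isNehariMinimizer_of_ne_top hσ hp hq hqp (hKpos n)
      ENNReal.ofReal_ne_top
    obtain ⟨s, hs⟩ := exists_le_abs_avg hp hq (hKpos n)
      ((mem_ansatz_iff hp hq (hKpos n)).1 hZ.mem).1 hZ.mass_pos hZ.nehari_eq.le hηp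
    exact ⟨_, hZ.shift hp hq (hKpos n) s, by rw [avg_comp_shift, zero_add]; exact hs⟩
  choose Y hY hYη using hex
  have hYL : ∀ n, CellL2 (ENNReal.ofReal (κ n)) (Y n) := fun n =>
    ((mem_ansatz_iff hp hq (hKpos n)).1 (hY n).mem).1
  set M := max (B / (σ ^ 2 * (1 / 2 - 1 / p))) (B / (1 - q / p))
  have hmass : ∀ n, mass (ENNReal.ofReal (κ n)) (Y n) ≤ M := fun n =>
    (mass_le_of_reducedAction_le hσ hp hqp (hB _ (hκ n) _ (hY n))).1.trans (le_max_left _ _)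
  have hpot : ∀ n, potentialPart q (ENNReal.ofReal (κ n)) (Y n) ≤ M := fun n =>
    (mass_le_of_reducedAction_le hσ hp hqp (hB _ (hκ n) _ (hY n))).2.trans (le_max_right _ _)
  obtain ⟨τ, hτ, V, a', b', hV2, hweak, ha', hb', hVa⟩ := exists_subseq_weak_limit hYL hmass
    (b := fun n => potentialPart q (ENNReal.ofReal (κ n)) (Y n))
    (fun n => potentialPart_nonneg _ _ _) hpot
  set K : ℕ → ℝ≥0∞ := fun n => ENNReal.ofReal (κ (τ n)) with hKdef
  set W : ℕ → ℝ → ℝ := fun n => Y (τ n) with hWdef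
  have hK : ∀ n, 0 < K n := fun n => hKpos _
  have hW : ∀ n, IsNehariMinimizer σ p q (K n) (W n) := fun n => hY _
  have hWL : ∀ n, CellL2 (K n) (W n) := fun n => hYL _
  have hcell : ∀ R : ℝ, ∀ᶠ n in atTop, Ioc (-R) R ⊆ cell (K n) := fun R =>
    hτ.tendsto_atTop.eventually (hcellR R)
  have hVL : CellL2 ∞ V := ⟨fun h => absurd rfl h, by rwa [cellMeasure_top]⟩
  have hmV : mass ∞ V = ∫ x, V x ^ 2 := by rw [mass, cellMeasure_top]
  have havg : ∀ φ, Tendsto (fun n => avg (W n) φ) atTop (𝓝 (avg V φ)) := by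
    intro φ
    have h1 := hweak _ (memLp_indicator_Ioc_one (φ - 1 / 2) (φ + 1 / 2))
    have e : avg V φ
        = ∫ s, V s * (Ioc (φ - 1 / 2) (φ + 1 / 2)).indicator (fun _ => (1 : ℝ)) s := by
      have := intervalIntegral_eq_integral_indicator (K := ∞) V
        (by linarith : φ - 1 / 2 ≤ φ + 1 / 2) (by rw [cell_top]; exact subset_univ _)
      rw [cell_top, indicator_univ] at this
      exact this
    rw [e]
    refine h1.congr' ?_
    filter_upwards [hcell (|φ| + 1 / 2)] with n hn
    refine (intervalIntegral_eq_integral_indicator (K := K n) (W n) (by linarith)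
      ((Ioc_subset_Ioc ?_ ?_).trans hn)).symm
    · linarith [neg_abs_le φ]
    · linarith [le_abs_self φ]
  -- Since `κ₀ ≥ 1`, each cell is longer than the window, so one period suffices and the bound is
  -- uniform in `n`.
  have hS : ∀ n φ, |avg (W n) φ| ≤ √M := by
    intro n φ
    refine ((hWL n).abs_avg_le (hK n) le_rfl (fun _ => ?_) φ).trans (Real.sqrt_le_sqrt ?_)
    · rw [hKdef]; simp only; rw [hKreal]; push_cast; linarith [hκ (τ n)]
    · rw [Nat.cast_one, one_mul]; exact hmass _
  obtain ⟨hVq, hVb⟩ := potentialPart_top_le_of_tendsto (by linarith : 0 < q) hK hcell hWL hVL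
    (fun n => ((mem_ansatz_iff hp hq (hK n)).1 (hW n).mem).2) hS havg hb'
  have hVmem : V ∈ ansatz p q ∞ :=
    (mem_ansatz_iff hp hq hTop).2 ⟨hVL, by rwa [cellMeasure_top]⟩
  have hV0 : 0 < mass ∞ V := by
    refine hVL.mass_pos_of_avg_ne_zero hTop (φ := 0) fun h0 => ?_
    have := ge_of_tendsto' (havg 0).abs fun n => hYη (τ n)
    rw [h0, abs_zero] at this; linarith
  have hforce := tendsto_avg_force hq hqp hK hWL hS havg (p := p)
  -- The wave equation is tested with the truncated limit: the linear term passes by weak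
  -- convergence, the force by pointwise convergence of averages and domination.
  have htest : ∀ R : ℝ, 0 < R → σ ^ 2 * ∫ x in (-R)..R, V x ^ 2
      = ∫ x in (-R)..R, avg (force p q V) x * V x := by
    intro R hR
    have hg : MemLp ((Ioc (-R) R).indicator V) 2 volume := hV2.indicator measurableSet_Ioc
    have h1 := (hweak _ hg).const_mul (σ ^ 2)
    have e1 : ∫ x, V x * (Ioc (-R) R).indicator V x = ∫ x in (-R)..R, V x ^ 2 := by
      rw [intervalIntegral.integral_of_le (by linarith), ← integral_indicator measurableSet_Ioc]
      congr 1; ext x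
      by_cases hx : x ∈ Ioc (-R) R <;> simp [hx, sq]
    rw [e1] at h1
    have h2 : Tendsto (fun n => ∫ x in (-R)..R, avg (force p q (W n)) x * V x) atTop
        (𝓝 (∫ x in (-R)..R, avg (force p q V) x * V x)) := by
      refine intervalIntegral.tendsto_integral_filter_of_dominated_convergence
        (fun x => (p * √M ^ (p - 1) + q * √M ^ (q - 1)) * |V x|)
        (Eventually.of_forall fun n => ?_)
        (Eventually.of_forall fun n => Eventually.of_forall fun x _ => ?_)
        ((hVL.intervalIntegrable hTop _ _).abs.const_mul _)
        (Eventually.of_forall fun x _ => (hforce x).mul_const _)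
      · exact ((continuous_avg fun x y => ((hWL n).continuous_force hq hqp
          (hK n)).intervalIntegrable x y).aestronglyMeasurable.mul hV2.1).restrict
      · rw [Real.norm_eq_abs, abs_mul]
        exact mul_le_mul_of_nonneg_right
          (abs_avg_le_of_abs_le (fun y => abs_force_le hq hqp (hS n y)) x) (abs_nonneg _)
    refine tendsto_nhds_unique h1 (h2.congr' ?_)
    filter_upwards [hcell R] with n hn
    have hwave := ((hW n).actionCritical hσ hp hq hqp (hK n)).travelingWaveEq hp hq hqp (hK n)
      (hW n).mem
    rw [intervalIntegral.integral_of_le (by linarith), ← integral_indicator measurableSet_Ioc,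
      ← integral_const_mul]
    refine integral_congr_ae ?_
    filter_upwards [hwave] with x hx
    by_cases hxR : x ∈ Ioc (-R) R
    · rw [indicator_of_mem hxR, indicator_of_mem hxR, indicator_of_mem (hn hxR),
        (hWL n).avg_force hq hqp (hK n), ← hx]
      ring
    · rw [indicator_of_notMem hxR, indicator_of_notMem hxR]; simp
  have hVn : nehari σ p q ∞ V = 0 := nehari_top_eq_zero hp hq hqp hVmem htest
  have c1 : 0 < σ ^ 2 * (1 / 2 - 1 / p) := by
    refine mul_pos hσ ?_
    rw [sub_pos, div_lt_div_iff₀ (by linarith) (by norm_num)]; linarith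
  have c2 : 0 < 1 - q / p := by
    rw [sub_pos, div_lt_one (by linarith)]; linarith
  have hEW : Tendsto (fun n => reducedAction σ p q (K n) (W n)) atTop
      (𝓝 (σ ^ 2 * (1 / 2 - 1 / p) * a' + (1 - q / p) * b')) :=
    (ha'.const_mul _).add (hb'.const_mul _)
  have hKlim : Tendsto (fun n => κ (τ n)) atTop atTop := hκlim.comp hτ.tendsto_atTop
  -- Replacing `U` by `t • U` with `t > 1` makes the Nehari functional strictly negative, as
  -- periodization requires; the cells grow first, then `t` decreases to `1`.
  have hupper : ∀ U ∈ ansatz p q ∞, 0 < mass ∞ U → nehari σ p q ∞ U = 0 →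
      σ ^ 2 * (1 / 2 - 1 / p) * a' + (1 - q / p) * b' ≤ reducedAction σ p q ∞ U := by
    intro U hU hUm hUn
    refine ge_of_tendsto (tendsto_reducedAction_smul U) ?_
    filter_upwards [self_mem_nhdsWithin] with t ht
    have ht1 : (1 : ℝ) < t := ht
    have htU := smul_mem_ansatz hU t
    have htn : nehari σ p q ∞ (t • U) < 0 := by
      rw [nehari_smul _ _ _ _ (by linarith)]
      exact fibre_deriv_neg hσ hp hq hqp hUm (potentialPart_nonneg _ _ _) hUn ht1
    have htm : 0 < mass ∞ (t • U) := by rw [mass_smul]; positivity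
    refine le_of_tendsto_of_tendsto hEW
      ((tendsto_reducedAction_periodize (σ := σ) hp hq htU).comp hKlim) ?_
    filter_upwards [hKlim.eventually (eventually_reducedAction_le hσ hp hq hqp htU htm htn)]
      with n hn using hn _ (hW n)
  have hlower : reducedAction σ p q ∞ V
      ≤ σ ^ 2 * (1 / 2 - 1 / p) * a' + (1 - q / p) * b' := by
    rw [reducedAction, hmV]
    have h1 := mul_le_mul_of_nonneg_left hVa c1.le
    have h2 := mul_le_mul_of_nonneg_left hVb c2.le
    linarith
  have hVmin : IsNehariMinimizer σ p q ∞ V :=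
    ⟨hVmem, hV0, hVn, fun U hU hUm hUn => hlower.trans (hupper U hU hUm hUn)⟩
  -- Equality of the actions leaves no room for either semicontinuity inequality to be strict; norm
  -- convergence together with weak convergence gives strong convergence.
  have haeq : a' = ∫ x, V x ^ 2 := by
    refine le_antisymm ?_ hVa
    have h1 := hupper V hVmem hV0 hVn
    rw [reducedAction, hmV] at h1
    have h2 := mul_le_mul_of_nonneg_left hVb c2.le
    have h3 : σ ^ 2 * (1 / 2 - 1 / p) * a' ≤ σ ^ 2 * (1 / 2 - 1 / p) * ∫ x, V x ^ 2 := by linarith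
    exact le_of_mul_le_mul_left h3 c1
  refine ⟨τ, hτ, W, V, hW, hVmin, tendsto_eLpNorm_two_zero
    (fun n => hV2.sub (hWL n).memLp_indicator) ?_⟩
  have h1 := ((hweak V hV2).const_mul 2).const_sub (∫ x, V x ^ 2)
  have h2 := h1.add ha'
  have e : (∫ x, V x ^ 2) - 2 * (∫ x, V x * V x) + a' = 0 := by
    simp only [← sq]; rw [haeq]; ring
  rw [e] at h2
  refine h2.congr fun n => ?_
  have hm := (hWL n).memLp_indicator
  have hmul : Integrable (fun x => 2 * ((cell (K n)).indicator (W n) x * V x)) volume :=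
    (hm.integrable_mul hV2).const_mul 2
  have hi : Integrable (fun x => V x ^ 2 - 2 * ((cell (K n)).indicator (W n) x * V x)) volume :=
    hV2.integrable_sq.sub hmul
  change (∫ x, V x ^ 2) - 2 * (∫ x, (cell (K n)).indicator (W n) x * V x) + mass (K n) (W n) = _
  rw [← integral_indicator_sq, ← integral_const_mul,
    ← integral_sub hV2.integrable_sq hmul,
    ← integral_add hi hm.integrable_sq]
  congr 1; ext x
  simp only [Pi.sub_apply]; ring

/-! ### Nonconstancy of ground waves on large cells. -/

/-- Constant waves on large cells have too much action. -/
lemma reducedAction_const_ge {σ p q : ℝ} (hσ : 0 < σ ^ 2) (hp : 2 < p) (hq : 1 < q)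
    (hqp : q < p) {η : ℝ} (hη : 0 < η) (hηp : p * η ^ (p - 2) < σ ^ 2) {K : ℝ≥0∞} (hK : 0 < K)
    (hT : K ≠ ∞) {W : ℝ → ℝ} (hW : CellL2 K W) (hm : 0 < mass K W)
    (hn : nehari σ p q K W = 0) {c : ℝ} (hc : W =ᵐ[volume] fun _ => c) :
    σ ^ 2 * (1 / 2 - 1 / p) * (2 * K.toReal * η ^ 2) ≤ reducedAction σ p q K W := by
  obtain ⟨φ, hφ⟩ := exists_le_abs_avg hp hq hK hW hm hn.le hηp
  have havg : avg W φ = c := by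
    rw [avg, intervalIntegral.integral_congr_ae (g := fun _ => c)
      (by filter_upwards [hc] with x hx _ using hx), intervalIntegral.integral_const]
    simp; ring
  rw [havg] at hφ
  have hmass : mass K W = 2 * K.toReal * c ^ 2 := by
    have hc' : (fun x => W x ^ 2) =ᵐ[cellMeasure K] fun _ => c ^ 2 := by
      filter_upwards [Measure.absolutelyContinuous_of_le (cellMeasure_le_volume K) hc] with x hx
      rw [hx]
    rw [mass, integral_congr_ae hc', integral_cellMeasure_of_ne_top hT,
      intervalIntegral.integral_const, smul_eq_mul]
    ring
  have hsq : η ^ 2 ≤ c ^ 2 := by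
    rw [← sq_abs c]; exact pow_le_pow_left₀ hη.le hφ 2
  have c1 : 0 < σ ^ 2 * (1 / 2 - 1 / p) := by
    refine mul_pos hσ ?_
    rw [sub_pos, div_lt_div_iff₀ (by linarith) (by norm_num)]; linarith
  have c2 : 0 ≤ 1 - q / p := by
    rw [sub_nonneg, div_le_one (by linarith)]; linarith
  have hb := mul_nonneg c2 (potentialPart_nonneg q K W)
  have hK0 : 0 ≤ K.toReal := K.toReal_nonneg
  rw [reducedAction, hmass]
  have h1 : σ ^ 2 * (1 / 2 - 1 / p) * (2 * K.toReal * η ^ 2)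
      ≤ σ ^ 2 * (1 / 2 - 1 / p) * (2 * K.toReal * c ^ 2) := by gcongr
  linarith

/-- An arbitrary ground wave is compared with a Nehari minimizer, which is itself a critical point;
bounds for minimizers thus transfer to all ground waves. -/
lemma IsGroundWave.reducedAction_le {σ p q : ℝ} (hσ : 0 < σ ^ 2) (hp : 2 < p) (hq : 1 < q)
    (hqp : q < p) {K : ℝ≥0∞} (hK : 0 < K) {W Z : ℝ → ℝ} (hW : IsGroundWave σ p q K W)
    (hZ : IsNehariMinimizer σ p q K Z) : reducedAction σ p q K W ≤ reducedAction σ p q K Z := by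
  rw [← action_eq_reducedAction hp hZ.nehari_eq,
    ← action_eq_reducedAction hp (hW.mem.2.2.nehari_eq hp hq hqp hK hW.mem.1)]
  exact hW.isLeast.2 (mem_image_of_mem _ (hZ.isGroundWave hσ hp hq hqp hK).mem)

theorem exists_forall_groundWave_not_const {σ p q : ℝ} (hσ : 0 < σ ^ 2) (hp : 2 < p) (hq : 1 < q)
    (hqp : q < p) :
    ∃ K₀ : ℝ, ∀ K : ℝ≥0∞, ENNReal.ofReal K₀ < K →
      ∀ W, IsGroundWave σ p q K W → ¬ ∃ c : ℝ, W =ᵐ[volume] fun _ => c := by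
  obtain ⟨κ₀, B, hκ₀, hB⟩ := exists_reducedAction_bound hσ hp hq hqp
  obtain ⟨η, hη, hηp⟩ := exists_pos_mul_rpow_lt hσ hp
  have c1 : 0 < σ ^ 2 * (1 / 2 - 1 / p) := by
    refine mul_pos hσ ?_
    rw [sub_pos, div_lt_div_iff₀ (by linarith) (by norm_num)]; linarith
  set D := σ ^ 2 * (1 / 2 - 1 / p) * (2 * η ^ 2) with hD
  have hD0 : 0 < D := by positivity
  -- Beyond `κ₀` the least action is at most `B`; beyond `B / D` the lower bound `K * D` for
  -- constants exceeds it.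
  refine ⟨max κ₀ (B / D), fun K hK W hW ⟨c, hc⟩ => ?_⟩
  have hK0 : 0 < K := lt_of_le_of_lt zero_le hK
  have hm := nontrivialCriticalPoints_mass_pos hp hq hK0 hW.mem
  have hWL := ((mem_ansatz_iff hp hq hK0).1 hW.mem.1).1
  by_cases hT : K = ∞
  -- On the line, square integrability alone forces a constant to be zero.
  · subst hT
    have h2 := hWL.memLp
    rw [cellMeasure_top, memLp_congr_ae hc, memLp_const_iff (by norm_num) (by norm_num)] at h2
    rcases h2 with h2 | h2
    · subst h2; exact hW.mem.2.1 hc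
    · simp at h2
  · have hlt : max κ₀ (B / D) < K.toReal := (ENNReal.ofReal_lt_iff_lt_toReal
      (le_trans (by linarith) (le_max_left _ _)) hT).1 hK
    have hKeq : ENNReal.ofReal K.toReal = K := ENNReal.ofReal_toReal hT
    obtain ⟨Z, hZ⟩ := exists_isNehariMinimizer_of_ne_top hσ hp hq hqp hK0 hT
    have h1 := hW.reducedAction_le hσ hp hq hqp hK0 hZ
    have h2 := hB K.toReal ((le_max_left _ _).trans hlt.le) Z (by rwa [hKeq])
    rw [hKeq] at h2
    have h3 := reducedAction_const_ge hσ hp hq hqp hη hηp hK0 hT hWL hm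
      (hW.mem.2.2.nehari_eq hp hq hqp hK0 hW.mem.1) hc
    have h4 : B < K.toReal * D :=
      (div_lt_iff₀ hD0).1 ((le_max_right _ _).trans_lt hlt)
    have h5 : σ ^ 2 * (1 / 2 - 1 / p) * (2 * K.toReal * η ^ 2) = K.toReal * D := by
      rw [hD]; ring
    linarith

lemma frequently_le_of_not_bddAbove {κ : ℕ → ℝ} (h : ¬ BddAbove (range κ)) (C : ℝ) :
    ∃ᶠ n in atTop, C ≤ κ n := by
  intro hev
  obtain ⟨N, hN⟩ := eventually_atTop.1 hev
  obtain ⟨M, hM⟩ := ((finite_Iio N).image κ).bddAbove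
  refine h ⟨max M C, ?_⟩
  rintro _ ⟨n, rfl⟩
  rcases lt_or_ge n N with hn | hn
  · exact (hM (mem_image_of_mem κ hn)).trans (le_max_left _ _)
  · exact (not_le.1 (hN n hn)).le.trans (le_max_right _ _)

end GroundWaves

end

theorem theorem1 (σ p q : ℝ) (hσ : 0 < σ ^ 2) (hp : 2 < p) (hq : 1 < q) (hqp : q < p) :
    (∀ K : ℝ≥0∞, 0 < K → ∃ W ∈ GroundWaves.ansatz p q K,
      GroundWaves.IsGroundWave σ p q K W ∧
      GroundWaves.TravelingWaveEq σ p q W ∧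
      0 < GroundWaves.action σ p q K W ∧
      IsLeast
        (GroundWaves.action σ p q K '' GroundWaves.nontrivialCriticalPoints σ p q K)
        (GroundWaves.action σ p q K W)) ∧
    (∃ K₀ : ℝ, ∀ K : ℝ≥0∞, ENNReal.ofReal K₀ < K →
      ∀ W, GroundWaves.IsGroundWave σ p q K W → ¬ ∃ c : ℝ, W =ᵐ[volume] fun _ => c) ∧
    (∀ κ : ℕ → ℝ, (∀ m, 0 < κ m) → ¬ BddAbove (Set.range κ) →
      ∃ τ : ℕ → ℕ, StrictMono τ ∧ Tendsto (fun n => κ (τ n)) atTop atTop ∧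
        ∃ (Wper : ℕ → ℝ → ℝ) (Wsol : ℝ → ℝ),
          (∀ n, GroundWaves.IsGroundWave σ p q (ENNReal.ofReal (κ (τ n))) (Wper n)) ∧
          GroundWaves.IsGroundWave σ p q ∞ Wsol ∧
          Tendsto
            (fun n => eLpNorm
              (Wsol - (GroundWaves.cell (ENNReal.ofReal (κ (τ n)))).indicator (Wper n))
              2 volume)
            atTop (𝓝 0)) := by
  obtain ⟨κ₀, B, hκ₀, hB⟩ := GroundWaves.exists_reducedAction_bound hσ hp hq hqp
  refine ⟨fun K hK => ?_, GroundWaves.exists_forall_groundWave_not_const hσ hp hq hqp,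
    fun κ hκ hunb => ?_⟩
  · obtain ⟨W, hW⟩ : ∃ W, GroundWaves.IsNehariMinimizer σ p q K W := by
      by_cases hT : K = ∞
      · subst hT
        -- The solitary minimizer arises as the limit of periodic ones; any sequence of half-periods
        -- above `κ₀` tending to infinity serves.
        obtain ⟨-, -, -, V, -, hV, -⟩ := GroundWaves.exists_tendsto_isNehariMinimizer hσ hp hq hqp
          hκ₀ hB (κ := fun n => κ₀ + n) (fun n => by simp)
          (tendsto_atTop_add_const_left _ _ tendsto_natCast_atTop_atTop)
        exact ⟨V, hV⟩
      · exact GroundWaves.exists_isNehariMinimizer_of_ne_top hσ hp hq hqp hK hT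
    have hG := hW.isGroundWave hσ hp hq hqp hK
    exact ⟨W, hW.mem, hG, hG.wave_eq, hW.action_pos hσ hp hqp, hG.isLeast⟩
  -- The threshold `κ₀ + n` secures both divergence and the lower bound `κ₀` along the whole
  -- subsequence.
  · obtain ⟨τ₁, hτ₁, hle⟩ := extraction_forall_of_frequently
      (P := fun n k => κ₀ + (n : ℝ) ≤ κ k)
      fun n => GroundWaves.frequently_le_of_not_bddAbove hunb _
    have hlim : Tendsto (fun n => κ (τ₁ n)) atTop atTop :=
      tendsto_atTop_mono hle (tendsto_atTop_add_const_left _ _ tendsto_natCast_atTop_atTop)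
    obtain ⟨τ₂, hτ₂, W, V, hW, hV, hconv⟩ := GroundWaves.exists_tendsto_isNehariMinimizer
      hσ hp hq hqp hκ₀ hB (κ := fun n => κ (τ₁ n))
      (fun n => le_trans (by simp) (hle n)) hlim
    exact ⟨τ₁ ∘ τ₂, hτ₁.comp hτ₂, hlim.comp hτ₂.tendsto_atTop, W, V,
      fun n => (hW n).isGroundWave hσ hp hq hqp (ENNReal.ofReal_pos.2 (hκ _)),
      hV.isGroundWave hσ hp hq hqp ENNReal.zero_lt_top, hconv⟩
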